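/- Let $d\in\mathbb N_0$, $T>0$, $p\in(2,3)$, and let $\mathbf X=(X,\mathbb X^{(2)})$ be a continuous $p$-rough path over $\mathbb R^d$ on $[0,T]$: $X:[0,T]\to\mathbb R^d$ is continuous of finite $p$-variation, $\mathbb X^{(2)}:\{0\le s\le t\le T\}\to\mathbb R^{d\times d}$ is continuous of finite $p/2$-variation, and $(\mathbb X^{(2)}_{s,t})^{ij}=(\mathbb X^{(2)}_{s,u})^{ij}+(\mathbb X^{(2)}_{u,t})^{ij}+X^i_{s,u}X^j_{u,t}$ for $s\le u\le t$, where $X_{s,t}:=X_t-X_s$; $\mathbf X$ need not be geometric. Let $$[\mathbf X]_t:=X_{0,t}\otimes X_{0,t}-\big(\mathbb X^{(2)}_{0,t}+(\mathbb X^{(2)}_{0,t})^\top\big)$$ be its bracket, and let $\widehat X_t:=\big(t,X_t,([\mathbf X]^{ij}_t)_{1\le i\le j\le d}\big)\in\mathbb R^{\hat d}$, $\hat d=1+d+\frac{d(d+1)}2$, be the path extended by time and the bracket terms. Index its components by $0,\dots,\hat d-1$, with $0$ for time and $1,\dots,d$ for $X$, let $e_0,\dots,e_{\hat d-1}$ be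 the canonical basis of $\mathbb R^{\hat d}$, let $\epsilon_{ij}=\epsilon_{ji}$ be the basis vector of the component $[\mathbf X]^{ij}$ for $1\le i\le j\le d$, and put $\epsilon_{ij}:=0$ unless both $i,j\in\{1,\dots,d\}$. For a word $I=(i_1,\dots,i_n)$ in $\{0,\dots,\hat d-1\}$ write $e_I=e_{i_1}\otimes\dots\otimes e_{i_n}$, and $I'=(i_1,\dots,i_{n-1})$ if $n\ge1$. Let $\widehat{\mathbb X}^{(2)}$ be the canonical second level over $\widehat X$: for $0\le s\le t\le T$, $(\widehat{\mathbb X}^{(2)}_{s,t})^{ij}=(\mathbb X^{(2)}_{s,t})^{ij}$ if $i,j\in\{1,\dots,d\}$, and otherwise $(\widehat{\mathbb X}^{(2)}_{s,t})^{ij}=\int_s^t\widehat X^i_{s,r}\,\mathrm d\widehat X^j_r$ as a Young integral (limit of left-point Riemann sums as the mesh tends to $0$). Let $\widehat{\mathbb X}$ be Lyons' extension of $(1,\widehat X,\widehat{\mathbb X}^{(2)})$, that is, the continuous map $(s,t)\mapsto\widehat{\mathbb X}_{s,t}\in T((\mathbb R^{\hat d}))$, $0\le s\le t\le T$, with levels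 $0,1,2$ equal to $1,\widehat X_{s,t},\widehat{\mathbb X}^{(2)}_{s,t}$, with $\widehat{\mathbb X}_{s,u}\otimes\widehat{\mathbb X}_{u,t}=\widehat{\mathbb X}_{s,t}$ for $s\le u\le t$, and whose level $m$ has finite $p/m$-variation for every $m\ge1$; write $\widehat{\mathbb X}_t:=\widehat{\mathbb X}_{0,t}$. These objects are well defined: the Young integrals exist, $(\widehat X,\widehat{\mathbb X}^{(2)})$ is a continuous $p$-rough path over $\mathbb R^{\hat d}$, and it has a Lyons extension. Define the quasi-shuffle product recursively by $e_I\,\widetilde{\sqcup\!\sqcup}\,e_\emptyset=e_\emptyset\,\widetilde{\sqcup\!\sqcup}\,e_I=e_I$ and, for non-empty words $I,J$ with last letters $i,j$, $$e_I\,\widetilde{\sqcup\!\sqcup}\,e_J=(e_{I'}\,\widetilde{\sqcup\!\sqcup}\,e_J)\otimes e_i+(e_I\,\widetilde{\sqcup\!\sqcup}\,e_{J'})\otimes e_j+(e_{I'}\,\widetilde{\sqcup\!\sqcup}\,e_{J'})\otimes\epsilon_{ij}.$$ Then for all words $I,J$ with letters in $\{0,\dots,\hat d-1\}$ and all $t\in[0,T]$,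 $$\langle e_I,\widehat{\mathbb X}_t\rangle\,\langle e_J,\widehat{\mathbb X}_t\rangle=\langle e_I\,\widetilde{\sqcup\!\sqcup}\,e_J,\widehat{\mathbb X}_t\rangle .$$ -/

import Mathlib

open Filter Topology

noncomputable section

namespace RoughSig

/-! ### Partitions and variation -/

/-- A partition `s = u₀ < u₁ < ⋯ < uₙ = t` of `[s, t]`. -/
structure Partition (s t : ℝ) where
  n : ℕ
  pt : Fin (n + 1) → ℝ
  strictMono : StrictMono pt
  first : pt 0 = s
  last : pt (Fin.last n) = t

/-- The mesh size `max (u_{i+1} - u_i)` (and `0` for the one-point partition of `[s, s]`). -/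
def Partition.mesh {s t : ℝ} (P : Partition s t) : ℝ :=
  ⨆ i : Fin P.n, (P.pt i.succ - P.pt i.castSucc)

/-- The filter describing the limit `mesh → 0` along all partitions of `[s, t]`. -/
def meshZero (s t : ℝ) : Filter (Partition s t) := comap Partition.mesh (𝓝 0)

/-- The `r`-variation over `[s, t]` of a two-parameter function. -/
def variation {E : Type*} [NormedAddCommGroup E] (r : ℝ) (A : ℝ → ℝ → E) (s t : ℝ) : ENNReal :=
  (⨆ P : Partition s t, ∑ i : Fin P.n, ‖A (P.pt i.castSucc) (P.pt i.succ)‖ₑ ^ r) ^ (1 / r)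

/-- The simplex `{(s, t) : 0 ≤ s ≤ t ≤ T}`. -/
def simplex (T : ℝ) : Set (ℝ × ℝ) := {x | 0 ≤ x.1 ∧ x.1 ≤ x.2 ∧ x.2 ≤ T}

/-- `∫_s^t f dg = L` as a Young integral: the left-point Riemann sums converge to `L` as the
mesh of the partition tends to zero. -/
def HasYoungIntegral (f g : ℝ → ℝ) (s t L : ℝ) : Prop :=
  Tendsto (fun P : Partition s t =>
    ∑ i : Fin P.n, f (P.pt i.castSucc) * (g (P.pt i.succ) - g (P.pt i.castSucc)))
    (meshZero s t) (𝓝 L)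

/-! ### Rough paths -/

/-- `(X, 𝕏)` is a continuous `p`-rough path on `[0, T]` over `ℝ^ι`; only the values of `X` on
`[0, T]` and those of `𝕏` on the simplex matter. -/
structure IsRoughPath {ι : Type*} [Fintype ι] (p T : ℝ) (X : ℝ → EuclideanSpace ℝ ι)
    (XX : ℝ → ℝ → EuclideanSpace ℝ (ι × ι)) : Prop where
  continuousOn_fst : ContinuousOn X (Set.Icc 0 T)
  variation_fst : variation p (fun s t => X t - X s) 0 T < ⊤
  continuousOn_snd : ContinuousOn (fun x : ℝ × ℝ => XX x.1 x.2) (simplex T)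
  variation_snd : variation (p / 2) XX 0 T < ⊤
  chen : ∀ s u t : ℝ, 0 ≤ s → s ≤ u → u ≤ t → t ≤ T → ∀ i j : ι,
    XX s t (i, j) = XX s u (i, j) + XX u t (i, j) + (X u i - X s i) * (X t j - X u j)

/-- The bracket `[𝐗]_t = X_{0,t} ⊗ X_{0,t} - (𝕏_{0,t} + 𝕏_{0,t}ᵀ)`. -/
def bracket {ι : Type*} (X : ℝ → EuclideanSpace ℝ ι)
    (XX : ℝ → ℝ → EuclideanSpace ℝ (ι × ι)) (t : ℝ) (i j : ι) : ℝ :=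
  (X t i - X 0 i) * (X t j - X 0 j) - (XX 0 t (i, j) + XX 0 t (j, i))

/-- The index set of the extended path: time, the `d` components of `X`, and the bracket
components `ij` with `i ≤ j`; it has `1 + d + d (d + 1) / 2` elements. -/
inductive ExtIndex (d : ℕ) where
  | time : ExtIndex d
  | path (i : Fin d) : ExtIndex d
  | brack (ij : {ij : Fin d × Fin d // ij.1 ≤ ij.2}) : ExtIndex d
  deriving DecidableEq, Fintype

/-- The extended path `X̂_t = (t, X_t, ([𝐗]^{ij}_t)_{i ≤ j})`. -/
def extPath {d : ℕ} (X : ℝ → EuclideanSpace ℝ (Fin d))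
    (XX : ℝ → ℝ → EuclideanSpace ℝ (Fin d × Fin d)) (t : ℝ) :
    EuclideanSpace ℝ (ExtIndex d) :=
  WithLp.toLp 2 fun a => match a with
    | .time => t
    | .path i => X t i
    | .brack ij => bracket X XX t ij.1.1 ij.1.2

/-- `XXh` is the canonical second level of the extended path: it is `𝕏` on the components of `X`,
and every other component is the Young integral `∫_s^t X̂^a_{s,r} dX̂^b_r`. -/
structure IsExtLift {d : ℕ} (T : ℝ) (X : ℝ → EuclideanSpace ℝ (Fin d))
    (XX : ℝ → ℝ → EuclideanSpace ℝ (Fin d × Fin d))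
    (XXh : ℝ → ℝ → EuclideanSpace ℝ (ExtIndex d × ExtIndex d)) : Prop where
  path_path : ∀ s t : ℝ, 0 ≤ s → s ≤ t → t ≤ T → ∀ i j : Fin d,
    XXh s t (.path i, .path j) = XX s t (i, j)
  young : ∀ s t : ℝ, 0 ≤ s → s ≤ t → t ≤ T → ∀ a b : ExtIndex d,
    ¬ ((∃ i, a = .path i) ∧ ∃ j, b = .path j) →
    HasYoungIntegral (fun r => extPath X XX r a - extPath X XX s a)
      (fun r => extPath X XX r b) s t (XXh s t (a, b))

/-! ### Tensor series and Lyons' extension -/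

/-- Tensor series `T((ℝ^ι))`: the coefficient of `e_I` for each word `I`. -/
abbrev TSeries (ι : Type*) := List ι → ℝ

/-- The product `⊗` of tensor series. -/
def TSeries.tensor {ι : Type*} (a b : TSeries ι) : TSeries ι := fun w =>
  ∑ k ∈ Finset.range (w.length + 1), a (w.take k) * b (w.drop k)

/-- The level-`m` component, an element of `(ℝ^ι)^{⊗ m}` with its Euclidean norm. -/
def TSeries.level {ι : Type*} (m : ℕ) (a : TSeries ι) : EuclideanSpace ℝ (Fin m → ι) :=
  WithLp.toLp 2 fun w => a (List.ofFn w)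

/-- `S` is Lyons' extension of `(1, X, 𝕏)`: a continuous multiplicative functional
`(s, t) ↦ S_{s,t}` with values in `T((ℝ^ι))` that agrees with `(1, X, 𝕏)` up to level two and has
finite `p`-variation, i.e. its level `m` has finite `p/m`-variation for every `m ≥ 1`.
The associated path is `t ↦ S_{0,t}`. -/
structure IsLyonsExtension {ι : Type*} [Fintype ι] (p T : ℝ) (X : ℝ → EuclideanSpace ℝ ι)
    (XX : ℝ → ℝ → EuclideanSpace ℝ (ι × ι)) (S : ℝ → ℝ → TSeries ι) : Prop where
  level_zero : ∀ s t : ℝ, 0 ≤ s → s ≤ t → t ≤ T → S s t [] = 1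
  level_one : ∀ s t : ℝ, 0 ≤ s → s ≤ t → t ≤ T → ∀ i, S s t [i] = X t i - X s i
  level_two : ∀ s t : ℝ, 0 ≤ s → s ≤ t → t ≤ T → ∀ i j, S s t [i, j] = XX s t (i, j)
  chen : ∀ s u t : ℝ, 0 ≤ s → s ≤ u → u ≤ t → t ≤ T → (S s u).tensor (S u t) = S s t
  continuousOn : ∀ w, ContinuousOn (fun x : ℝ × ℝ => S x.1 x.2 w) (simplex T)
  variation_lt_top : ∀ m : ℕ, 1 ≤ m →
    variation (p / m) (fun s t => (S s t).level m) 0 T < ⊤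

/-! ### The tensor algebra and the quasi-shuffle product -/

/-- The tensor algebra `T(ℝ^ι)`, with basis the words; its multiplication is `⊗`. -/
abbrev TAlg (ι : Type*) := MonoidAlgebra ℝ (FreeMonoid ι)

/-- The basis element `e_I`. -/
def e {ι : Type*} (I : List ι) : TAlg ι := MonoidAlgebra.single (FreeMonoid.ofList I) 1

/-- The pairing `⟨ℓ, a⟩` of `ℓ ∈ T(ℝ^ι)` with `a ∈ T((ℝ^ι))`. -/
def pairing {ι : Type*} (l : TAlg ι) (a : TSeries ι) : ℝ :=
  Finsupp.sum l.coeff fun w c => c * a (FreeMonoid.toList w)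

/-- The bracket letter `ε_{ij} = ε_{ji}`, set to `0` unless both indices belong to `X`. -/
def eps {d : ℕ} : ExtIndex d → ExtIndex d → TAlg (ExtIndex d)
  | .path i, .path j => e [.brack ⟨(min i j, max i j), min_le_max⟩]
  | _, _ => 0

/-- The quasi-shuffle recursion on words read from right to left (the head is the last letter). -/
def quasiShuffleRev {d : ℕ} : List (ExtIndex d) → List (ExtIndex d) → TAlg (ExtIndex d)
  | [], J => e J.reverse
  | i :: I, [] => e (i :: I).reverse
  | i :: I, j :: J =>
      quasiShuffleRev I (j :: J) * e [i] + quasiShuffleRev (i :: I) J * e [j]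
        + quasiShuffleRev I J * eps i j
  termination_by I J => I.length + J.length

/-- The quasi-shuffle product of `e_I` and `e_J`. -/
def quasiShuffle {d : ℕ} (I J : List (ExtIndex d)) : TAlg (ExtIndex d) :=
  quasiShuffleRev I.reverse J.reverse

theorem quasiShuffle_nil_left {d : ℕ} (J : List (ExtIndex d)) : quasiShuffle [] J = e J := by
  simp [quasiShuffle, quasiShuffleRev]

theorem quasiShuffle_nil_right {d : ℕ} (I : List (ExtIndex d)) : quasiShuffle I [] = e I := by
  rcases h : I.reverse with _ | ⟨i, I'⟩
  · simp_all [quasiShuffle, quasiShuffleRev]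
  · have h' : I = (i :: I').reverse := by rw [← h, List.reverse_reverse]
    simp only [quasiShuffle, h, List.reverse_nil, quasiShuffleRev]
    rw [h']

theorem quasiShuffle_concat {d : ℕ} (I J : List (ExtIndex d)) (i j : ExtIndex d) :
    quasiShuffle (I ++ [i]) (J ++ [j]) =
      quasiShuffle I (J ++ [j]) * e [i] + quasiShuffle (I ++ [i]) J * e [j]
        + quasiShuffle I J * eps i j := by
  simp [quasiShuffle, quasiShuffleRev]

end RoughSig

end

/-!
Besides the second level of the rough path, time and the bracket also have finite `p / 2`-variation.
So give the letters of `X` weight one and the other letters weight two. The products of the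
components of lower weight make up the failure of a component of weight `m ≥ 3` to be additive in
`(s, t)`, and they are of order `ω ^ (m / p)` for a control `ω`. Since `m / p > 1`, sewing yields a
multiplicative functional whose component at a word of weight `m` is of order `ω ^ (m / p)`. By
uniqueness of Lyons' extension it is `S`, which is therefore smaller than its definition demands.

Both sides of the quasi-shuffle identity, taken between `s` and `t`, are multiplicative for the
deconcatenation of the pair `(I, J)`: concatenation and quasi-shuffle form a bialgebra. By induction
on the lengths, the difference of the two sides is additive in `(s, t)`. If `I` and `J` are single
letters of `X`, the difference vanishes by the definition of the bracket; otherwise its weight `m`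
is at least three, and an additive function of order `ω ^ (m / p)` is zero.
-/

noncomputable section

namespace RoughSig

/-! ### Partitions -/

namespace Partition

variable {s t u : ℝ}

/-- The sum of a two-parameter function over the consecutive pairs of a partition. -/
def sum {M : Type*} [AddCommMonoid M] (P : Partition s t) (f : ℝ → ℝ → M) : M :=
  ∑ i : Fin P.n, f (P.pt i.castSucc) (P.pt i.succ)

theorem mem_Icc (P : Partition s t) (i : Fin (P.n + 1)) : P.pt i ∈ Set.Icc s t :=
  ⟨P.first.symm.trans_le (P.strictMono.monotone (Fin.zero_le _)),
    (P.strictMono.monotone (Fin.le_last _)).trans_eq P.last⟩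

theorem pt_lt_pt_succ (P : Partition s t) (i : Fin P.n) : P.pt i.castSucc < P.pt i.succ :=
  P.strictMono i.castSucc_lt_succ

theorem le_mesh (P : Partition s t) (i : Fin P.n) : P.pt i.succ - P.pt i.castSucc ≤ P.mesh :=
  le_ciSup (f := fun i : Fin P.n => P.pt i.succ - P.pt i.castSucc) (Set.finite_range _).bddAbove i

theorem sum_sub {E : Type*} [AddCommGroup E] (P : Partition s t) (f : ℝ → E) :
    P.sum (fun u v => f v - f u) = f t - f s := by
  have h := (Fin.sum_univ_succ (f ∘ P.pt)).symm.trans (Fin.sum_univ_castSucc (f ∘ P.pt))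
  simp only [Function.comp_apply, P.first, P.last] at h
  rw [sum, Finset.sum_sub_distrib, sub_eq_sub_iff_add_eq_add, add_comm, h, add_comm]

theorem norm_sum_le {E : Type*} [SeminormedAddCommGroup E] (P : Partition s t) (f : ℝ → ℝ → E) :
    ‖P.sum f‖ ≤ P.sum fun u v => ‖f u v‖ :=
  _root_.norm_sum_le _ _

theorem sum_le_sum (P : Partition s t) {f g : ℝ → ℝ → ℝ}
    (h : ∀ u v, s ≤ u → u < v → v ≤ t → v - u ≤ P.mesh → f u v ≤ g u v) : P.sum f ≤ P.sum g :=
  Finset.sum_le_sum fun i _ =>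
    h _ _ (P.mem_Icc _).1 (P.pt_lt_pt_succ i) (P.mem_Icc _).2 (P.le_mesh i)

/-- The one-point partition. -/
def refl (s : ℝ) : Partition s s :=
  ⟨0, fun _ => s, fun _ _ h => absurd h (by omega), rfl, rfl⟩

/-- The partition `s < u = u₀ < ⋯ < uₙ = t` obtained by adding a first point. -/
def cons (hsu : s < u) (P : Partition u t) : Partition s t where
  n := P.n + 1
  pt := Fin.cons s P.pt
  strictMono := by
    rw [Fin.strictMono_iff_lt_succ]
    refine Fin.cases ?_ fun j => ?_
    · simpa [P.first] using hsu
    · simpa using P.pt_lt_pt_succ j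
  first := rfl
  last := by rw [← Fin.succ_last, Fin.cons_succ, P.last]

section Sum

variable {M : Type*} [AddCommMonoid M] (f : ℝ → ℝ → M)

theorem sum_refl (s : ℝ) : (refl s).sum f = 0 := rfl

theorem sum_cons (hsu : s < u) (P : Partition u t) : (cons hsu P).sum f = f s u + P.sum f := by
  refine (Fin.sum_univ_succ fun i : Fin (P.n + 1) => _).trans ?_
  simp [sum, cons, P.first]

end Sum

theorem exists_append {M : Type*} [AddCommMonoid M] (P : Partition s u) (R : Partition u t) :
    ∃ Q : Partition s t, ∀ f : ℝ → ℝ → M, Q.sum f = P.sum f + R.sum f := by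
  obtain ⟨n, pt, hmono, rfl, rfl⟩ := P
  induction n with
  | zero => exact ⟨R, fun f => (zero_add _).symm⟩
  | succ n ih =>
    obtain ⟨Q, hQ⟩ := ih (fun i => pt i.succ) (hmono.comp (Fin.strictMono_succ)) R
    refine ⟨cons (hmono (Fin.succ_pos 0)) Q, fun f => ?_⟩
    rw [sum_cons, hQ f, ← add_assoc]
    congr 1
    exact (Fin.sum_univ_succ fun i : Fin (n + 1) => f (pt i.castSucc) (pt i.succ)).symm

theorem nonempty (hst : s ≤ t) : Nonempty (Partition s t) := by
  rcases hst.eq_or_lt with rfl | h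
  · exact ⟨refl s⟩
  · exact ⟨cons h (refl t)⟩

/-- The partition of `[s, t]` into `n + 1` intervals of equal length. -/
def uniform (hst : s < t) (n : ℕ) : Partition s t where
  n := n + 1
  pt i := s + i * ((t - s) / (n + 1))
  strictMono i j hij := by
    have hij' : ((i : ℕ) : ℝ) < ((j : ℕ) : ℝ) := by exact_mod_cast hij
    have hstep : 0 < (t - s) / ((n : ℝ) + 1) := div_pos (sub_pos.2 hst) (by positivity)
    exact add_lt_add_right (mul_lt_mul_of_pos_right hij' hstep) s
  first := by simp
  last := by
    have hn : (n : ℝ) + 1 ≠ 0 := by positivity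
    simp only [Fin.val_last, Nat.cast_add, Nat.cast_one, mul_div_cancel₀ _ hn,
      add_sub_cancel]

theorem mesh_uniform (hst : s < t) (n : ℕ) : (uniform hst n).mesh = (t - s) / (n + 1) := by
  have hstep : ∀ i : Fin (n + 1), (uniform hst n).pt i.succ - (uniform hst n).pt i.castSucc
      = (t - s) / (n + 1) := by
    intro i
    simp only [uniform, Fin.val_succ, Fin.val_castSucc, Nat.cast_add, Nat.cast_one]
    ring
  exact (iSup_congr hstep).trans (ciSup_const (ι := Fin (n + 1)))

end Partition

theorem meshZero_neBot {s t : ℝ} (hst : s ≤ t) : (meshZero s t).NeBot := by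
  refine comap_neBot_iff.2 fun U hU => ?_
  rcases hst.eq_or_lt with rfl | hlt
  · exact ⟨.refl s, by simpa [Partition.mesh, Partition.refl] using mem_of_mem_nhds hU⟩
  · have hlim : Tendsto (fun n : ℕ => (t - s) / ((n : ℝ) + 1)) atTop (𝓝 0) := by
      simpa [div_eq_mul_inv] using
        (tendsto_one_div_add_atTop_nhds_zero_nat (𝕜 := ℝ)).const_mul (t - s)
    obtain ⟨n, hn⟩ := (hlim.eventually hU).exists
    exact ⟨.uniform hlt n, by rwa [Partition.mesh_uniform]⟩

/-! ### Controls -/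

/-- A control on `[0, T]`: a finite nonnegative superadditive function on the simplex. No
continuity is required, so that the partition sums of a function of finite variation give one. -/
structure IsControl (T : ℝ) (ω : ℝ → ℝ → ℝ) : Prop where
  nonneg : ∀ s t, 0 ≤ s → s ≤ t → t ≤ T → 0 ≤ ω s t
  superadd : ∀ s u t, 0 ≤ s → s ≤ u → u ≤ t → t ≤ T → ω s u + ω u t ≤ ω s t

namespace IsControl

variable {T : ℝ} {ω ω' : ℝ → ℝ → ℝ}

theorem self_eq_zero (hω : IsControl T ω) {s : ℝ} (hs : 0 ≤ s) (hT : s ≤ T) : ω s s = 0 := by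
  linarith [hω.superadd s s s hs le_rfl le_rfl hT, hω.nonneg s s hs le_rfl hT]

theorem mono (hω : IsControl T ω) {a s t b : ℝ} (ha : 0 ≤ a) (has : a ≤ s) (hst : s ≤ t)
    (htb : t ≤ b) (hb : b ≤ T) : ω s t ≤ ω a b := by
  linarith [hω.superadd a s b ha has (hst.trans htb) hb,
    hω.superadd s t b (ha.trans has) hst htb hb,
    hω.nonneg a s ha has (hst.trans (htb.trans hb)),
    hω.nonneg t b (ha.trans (has.trans hst)) htb hb]

theorem add (hω : IsControl T ω) (hω' : IsControl T ω') :
    IsControl T (fun s t => ω s t + ω' s t) where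
  nonneg s t hs hst ht := add_nonneg (hω.nonneg s t hs hst ht) (hω'.nonneg s t hs hst ht)
  superadd s u t hs hsu hut ht := by
    linarith [hω.superadd s u t hs hsu hut ht, hω'.superadd s u t hs hsu hut ht]

theorem time (T : ℝ) : IsControl T (fun s t => t - s) where
  nonneg _ _ _ hst _ := sub_nonneg.2 hst
  superadd _ _ _ _ _ _ _ := by linarith

theorem sum_le (hω : IsControl T ω) {s t : ℝ} (hs : 0 ≤ s) (hst : s ≤ t) (ht : t ≤ T)
    (P : Partition s t) : P.sum ω ≤ ω s t := by
  calc P.sum ω ≤ P.sum fun u v => ω s v - ω s u := P.sum_le_sum fun u v hu huv hv _ => by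
        linarith [hω.superadd s u v hs hu huv.le (hv.trans ht)]
    _ = ω s t - ω s s := P.sum_sub (ω s)
    _ = ω s t := by rw [hω.self_eq_zero hs (hst.trans ht), sub_zero]

end IsControl

/-! ### Bounds by powers of a control -/

section PowBound

variable {E : Type*} [SeminormedAddCommGroup E] {T θ θ' : ℝ} {ω ω' : ℝ → ℝ → ℝ}

/-- The estimate `‖A s t‖ = O(ω(s, t) ^ θ)`, uniformly on the simplex. -/
def PowBound (T : ℝ) (ω : ℝ → ℝ → ℝ) (θ : ℝ) (A : ℝ → ℝ → E) : Prop :=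
  ∃ C, 0 ≤ C ∧ ∀ s t, 0 ≤ s → s ≤ t → t ≤ T → ‖A s t‖ ≤ C * ω s t ^ θ

namespace PowBound

variable {A B : ℝ → ℝ → E}

theorem congr (hA : PowBound T ω θ A)
    (h : ∀ s t, 0 ≤ s → s ≤ t → t ≤ T → B s t = A s t) : PowBound T ω θ B := by
  obtain ⟨C, hC, hb⟩ := hA
  exact ⟨C, hC, fun s t hs hst ht => h s t hs hst ht ▸ hb s t hs hst ht⟩

theorem zero : PowBound T ω θ (fun _ _ => (0 : E)) :=
  ⟨0, le_rfl, fun _ _ _ _ _ => by simp⟩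

theorem add (hA : PowBound T ω θ A) (hB : PowBound T ω θ B) :
    PowBound T ω θ (fun s t => A s t + B s t) := by
  obtain ⟨C, hC, hCb⟩ := hA
  obtain ⟨D, hD, hDb⟩ := hB
  refine ⟨C + D, by positivity, fun s t hs hst ht => ?_⟩
  rw [add_mul]
  exact norm_add_le_of_le (hCb s t hs hst ht) (hDb s t hs hst ht)

theorem neg (hA : PowBound T ω θ A) : PowBound T ω θ (fun s t => -A s t) := by
  simpa only [PowBound, norm_neg] using hA

theorem sub (hA : PowBound T ω θ A) (hB : PowBound T ω θ B) :
    PowBound T ω θ (fun s t => A s t - B s t) := by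
  simpa only [sub_eq_add_neg] using hA.add hB.neg

theorem const_mul {a : ℝ → ℝ → ℝ} (r : ℝ) (ha : PowBound T ω θ a) :
    PowBound T ω θ (fun s t => r * a s t) := by
  obtain ⟨C, hC, hb⟩ := ha
  refine ⟨|r| * C, by positivity, fun s t hs hst ht => ?_⟩
  rw [norm_mul, Real.norm_eq_abs, mul_assoc]
  gcongr
  exact hb s t hs hst ht

theorem mul {a b : ℝ → ℝ → ℝ} (hω : IsControl T ω) (hθ : 0 ≤ θ) (hθ' : 0 ≤ θ')
    (ha : PowBound T ω θ a) (hb : PowBound T ω θ' b) :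
    PowBound T ω (θ + θ') (fun s t => a s t * b s t) := by
  obtain ⟨C, hC, hCb⟩ := ha
  obtain ⟨D, hD, hDb⟩ := hb
  refine ⟨C * D, by positivity, fun s t hs hst ht => ?_⟩
  have hw := hω.nonneg s t hs hst ht
  calc ‖a s t * b s t‖ ≤ (C * ω s t ^ θ) * (D * ω s t ^ θ') :=
        norm_mul_le_of_le (hCb s t hs hst ht) (hDb s t hs hst ht)
    _ = C * D * ω s t ^ (θ + θ') := by rw [Real.rpow_add_of_nonneg hw hθ hθ']; ring

theorem exists_norm_mul_le {a b : ℝ → ℝ → ℝ} (hω : IsControl T ω) (hθ : 0 ≤ θ) (hθ' : 0 ≤ θ')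
    (ha : PowBound T ω θ a) (hb : PowBound T ω θ' b) :
    ∃ C, 0 ≤ C ∧ ∀ s u t, 0 ≤ s → s ≤ u → u ≤ t → t ≤ T →
      ‖a s u * b u t‖ ≤ C * ω s t ^ (θ + θ') := by
  obtain ⟨C, hC, hCb⟩ := ha
  obtain ⟨D, hD, hDb⟩ := hb
  refine ⟨C * D, by positivity, fun s u t hs hsu hut ht => ?_⟩
  have hu := hs.trans hsu
  have hsu0 := hω.nonneg s u hs hsu (hut.trans ht)
  have hut0 := hω.nonneg u t hu hut ht
  have hsu_le := hω.mono hs le_rfl hsu hut ht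
  have hut_le := hω.mono hs hsu hut le_rfl ht
  have hw := hsu0.trans hsu_le
  calc ‖a s u * b u t‖ ≤ (C * ω s u ^ θ) * (D * ω u t ^ θ') :=
        norm_mul_le_of_le (hCb s u hs hsu (hut.trans ht)) (hDb u t hu hut ht)
    _ ≤ (C * ω s t ^ θ) * (D * ω s t ^ θ') := by gcongr
    _ = C * D * ω s t ^ (θ + θ') := by rw [Real.rpow_add_of_nonneg hw hθ hθ']; ring

theorem mono_control (hω : IsControl T ω) (hθ : 0 ≤ θ)
    (h : ∀ s t, 0 ≤ s → s ≤ t → t ≤ T → ω s t ≤ ω' s t) (hA : PowBound T ω θ A) :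
    PowBound T ω' θ A := by
  obtain ⟨C, hC, hb⟩ := hA
  refine ⟨C, hC, fun s t hs hst ht => (hb s t hs hst ht).trans ?_⟩
  have := hω.nonneg s t hs hst ht
  have := h s t hs hst ht
  gcongr

theorem mono_exponent (hω : IsControl T ω) (hθ : 0 ≤ θ) (hle : θ ≤ θ')
    (hA : PowBound T ω θ' A) : PowBound T ω θ A := by
  obtain ⟨C, hC, hb⟩ := hA
  refine ⟨C * |ω 0 T| ^ (θ' - θ), by positivity, fun s t hs hst ht => ?_⟩
  have hw := hω.nonneg s t hs hst ht
  have hwT : ω s t ≤ |ω 0 T| := (hω.mono le_rfl hs hst ht le_rfl).trans (le_abs_self _)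
  have hsub : 0 ≤ θ' - θ := sub_nonneg.2 hle
  calc ‖A s t‖ ≤ C * ω s t ^ ((θ' - θ) + θ) := by simpa using hb s t hs hst ht
    _ = C * ω s t ^ (θ' - θ) * ω s t ^ θ := by
      rw [Real.rpow_add_of_nonneg hw hsub hθ, mul_assoc]
    _ ≤ C * |ω 0 T| ^ (θ' - θ) * ω s t ^ θ := by gcongr

end PowBound

end PowBound

theorem PowBound.self_eq_zero {E : Type*} [NormedAddCommGroup E] {T θ : ℝ} {ω : ℝ → ℝ → ℝ}
    {A : ℝ → ℝ → E} (hω : IsControl T ω) (hθ : θ ≠ 0) (hA : PowBound T ω θ A) {s : ℝ}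
    (hs : 0 ≤ s) (hT : s ≤ T) : A s s = 0 := by
  obtain ⟨C, -, hb⟩ := hA
  simpa [hω.self_eq_zero hs hT, Real.zero_rpow hθ] using hb s s hs le_rfl hT

/-! ### Smallness near the diagonal -/

theorem isCompact_simplex (T : ℝ) : IsCompact (simplex T) := by
  have hclosed : IsClosed (simplex T) :=
    (isClosed_le continuous_const continuous_fst).inter
      ((isClosed_le continuous_fst continuous_snd).inter
        (isClosed_le continuous_snd continuous_const))
  refine (isCompact_Icc.prod isCompact_Icc).of_isClosed_subset hclosed fun x hx =>
    (⟨⟨hx.1, hx.2.1.trans hx.2.2⟩, hx.1.trans hx.2.1, hx.2.2⟩ :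
      x ∈ Set.Icc 0 T ×ˢ Set.Icc 0 T)

section SmallDiag

variable {E : Type*} [SeminormedAddCommGroup E] {T θ : ℝ} {ω : ℝ → ℝ → ℝ} {A : ℝ → ℝ → E}

/-- A two-parameter function that tends to zero uniformly at the diagonal. -/
def SmallDiag (T : ℝ) (A : ℝ → ℝ → E) : Prop :=
  ∀ ε > 0, ∃ δ > 0, ∀ s t, 0 ≤ s → s ≤ t → t ≤ T → t - s < δ → ‖A s t‖ ≤ ε

theorem SmallDiag.of_continuousOn (hA : ContinuousOn (fun x : ℝ × ℝ => A x.1 x.2) (simplex T))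
    (hself : ∀ s, 0 ≤ s → s ≤ T → A s s = 0) : SmallDiag T A := by
  intro ε hε
  obtain ⟨δ, hδ, H⟩ := Metric.uniformContinuousOn_iff.1
    ((isCompact_simplex T).uniformContinuousOn_of_continuous hA) ε hε
  refine ⟨δ, hδ, fun s t hs hst ht hlt => ?_⟩
  have hsT := hst.trans ht
  have hdist : dist (s, t) (s, s) < δ := by
    simpa [Prod.dist_eq, Real.dist_eq, abs_of_nonneg (sub_nonneg.2 hst)] using ⟨hδ, hlt⟩
  simpa [hself s hs hsT] using (H (s, t) ⟨hs, hst, ht⟩ (s, s) ⟨hs, le_rfl, hsT⟩ hdist).le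

/-- For small `w` the excess power of `w` supplies the factor `η`, for large `w` the smallness of
`x` does. -/
theorem exists_forall_le_mul_rpow {K θ θ' η : ℝ} (hK : 0 ≤ K) (hθ' : 0 ≤ θ') (hθ : θ' < θ)
    (hη : 0 < η) : ∃ ε > 0, ∀ x w : ℝ, 0 ≤ w → x ≤ K * w ^ θ → x ≤ ε → x ≤ η * w ^ θ' := by
  have hgap : 0 < θ - θ' := sub_pos.2 hθ
  obtain ⟨c, hc, hcη⟩ : ∃ c > 0, K * c ^ (θ - θ') ≤ η := by
    refine ⟨(η / (K + 1)) ^ (θ - θ')⁻¹, by positivity, ?_⟩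
    rw [Real.rpow_inv_rpow (by positivity) hgap.ne', mul_div_left_comm]
    exact mul_le_of_le_one_right hη.le ((div_le_one (by positivity)).2 (by linarith))
  refine ⟨η * c ^ θ', by positivity, fun x w hw hxK hxε => ?_⟩
  rcases le_total w c with hwc | hcw
  · calc x ≤ K * w ^ ((θ - θ') + θ') := by simpa using hxK
      _ = K * w ^ (θ - θ') * w ^ θ' := by rw [Real.rpow_add_of_nonneg hw hgap.le hθ', mul_assoc]
      _ ≤ K * c ^ (θ - θ') * w ^ θ' := by gcongr
      _ ≤ η * w ^ θ' := by gcongr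
  · exact hxε.trans (by gcongr)

theorem SmallDiag.tendsto_sum (hω : IsControl T ω) (hA : SmallDiag T A) (hθ : 1 < θ)
    (hb : PowBound T ω θ A) {s t : ℝ} (hs : 0 ≤ s) (hst : s ≤ t) (ht : t ≤ T) :
    Tendsto (fun P : Partition s t => P.sum A) (meshZero s t) (𝓝 0) := by
  obtain ⟨C, hC, hb⟩ := hb
  refine Metric.tendsto_nhds.2 fun ε hε => ?_
  have hw := hω.nonneg s t hs hst ht
  set η := ε / (ω s t + 1) with hη
  obtain ⟨ε', hε', Hε⟩ := exists_forall_le_mul_rpow hC zero_le_one hθ (η := η) (by positivity)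
  obtain ⟨δ, hδ, Hδ⟩ := hA ε' hε'
  filter_upwards [tendsto_comap.eventually (gt_mem_nhds hδ)] with P hP
  calc dist (P.sum A) 0 = ‖P.sum A‖ := dist_zero_right _
    _ ≤ P.sum fun u v => ‖A u v‖ := P.norm_sum_le A
    _ ≤ P.sum fun u v => η * ω u v := P.sum_le_sum fun u v hu huv hv hmesh => by
      have hu0 := hs.trans hu
      have hvT := hv.trans ht
      simpa using Hε _ _ (hω.nonneg u v hu0 huv.le hvT) (hb u v hu0 huv.le hvT)
        (Hδ u v hu0 huv.le hvT (hmesh.trans_lt hP))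
    _ = η * P.sum ω := (Finset.mul_sum _ _ _).symm
    _ ≤ η * ω s t := by gcongr; exact hω.sum_le hs hst ht P
    _ < ε := by rw [hη, div_mul_eq_mul_div, div_lt_iff₀ (by positivity)]; linarith

end SmallDiag

theorem eq_zero_of_additive {E : Type*} [NormedAddCommGroup E] {T θ : ℝ} {ω : ℝ → ℝ → ℝ}
    {D : ℝ → ℝ → E} (hω : IsControl T ω)
    (hadd : ∀ s u t, 0 ≤ s → s ≤ u → u ≤ t → t ≤ T → D s t = D s u + D u t)
    (hcont : ContinuousOn (fun x : ℝ × ℝ => D x.1 x.2) (simplex T)) (hθ : 1 < θ)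
    (hb : PowBound T ω θ D) {s t : ℝ} (hs : 0 ≤ s) (hst : s ≤ t) (ht : t ≤ T) : D s t = 0 := by
  have hself : ∀ r, 0 ≤ r → r ≤ T → D r r = 0 := fun r => hb.self_eq_zero hω (by linarith)
  have hsum : ∀ P : Partition s t, P.sum D = D s t := fun P => by
    calc P.sum D = P.sum fun u v => D s v - D s u := Finset.sum_congr rfl fun i _ => by
          simp only [hadd s _ _ hs (P.mem_Icc _).1 (P.pt_lt_pt_succ i).le
            ((P.mem_Icc _).2.trans ht), add_sub_cancel_left]
      _ = D s t := by rw [P.sum_sub, hself s hs (hst.trans ht), sub_zero]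
  have hlim := (SmallDiag.of_continuousOn hcont hself).tendsto_sum hω hθ hb hs hst ht
  simp only [hsum] at hlim
  have := meshZero_neBot hst
  exact tendsto_nhds_unique tendsto_const_nhds hlim

/-! ### The sewing lemma -/

/-- `u < v` are neighbours in the finite set `F` of times. -/
structure IsConsecutive (F : Finset ℝ) (u v : ℝ) : Prop where
  left_mem : u ∈ F
  right_mem : v ∈ F
  lt : u < v
  le_of_lt : ∀ x ∈ F, u < x → v ≤ x

theorem exists_sub_eq_of_isConsecutive {E : Type*} [AddCommGroup E] (Ξ : ℝ → ℝ → E)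
    (F : Finset ℝ) : ∃ φ : ℝ → E, ∀ u v, IsConsecutive F u v → φ v - φ u = Ξ u v := by
  induction F using Finset.induction_on_max with
  | empty => exact ⟨0, fun u v huv => absurd huv.left_mem (Finset.notMem_empty u)⟩
  | insert a F ha ih =>
    obtain ⟨φ, hφ⟩ := ih
    rcases F.eq_empty_or_nonempty with rfl | hF
    · refine ⟨φ, fun u v ⟨hu, hv, huv, _⟩ => ?_⟩
      simp only [insert_empty_eq, Finset.mem_singleton] at hu hv
      exact absurd huv (hu.trans hv.symm).not_lt
    refine ⟨Function.update φ a (φ (F.max' hF) + Ξ (F.max' hF) a), fun u v ⟨hu, hv, huv, hn⟩ => ?_⟩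
    have huF : u ∈ F := (Finset.mem_insert.1 hu).resolve_left fun hua => by
      rcases Finset.mem_insert.1 hv with hva | hvF
      · exact huv.ne (hua.trans hva.symm)
      · exact (ha v hvF).not_gt (hua ▸ huv)
    rw [Function.update_of_ne (ha u huF).ne]
    rcases Finset.mem_insert.1 hv with rfl | hvF
    · have hmax : u = F.max' hF := (F.le_max' u huF).antisymm <| not_lt.1 fun hlt =>
        (ha _ (F.max'_mem hF)).not_ge (hn _ (Finset.mem_insert_of_mem (F.max'_mem hF)) hlt)
      rw [Function.update_self, ← hmax, add_sub_cancel_left]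
    · rw [Function.update_of_ne (ha v hvF).ne]
      exact hφ u v ⟨huF, hvF, huv, fun x hx => hn x (Finset.mem_insert_of_mem hx)⟩

theorem IsControl.exists_isConsecutive_le_half {T : ℝ} {ω : ℝ → ℝ → ℝ} (hω : IsControl T ω)
    {F : Finset ℝ} {s t : ℝ} (hsF : s ∈ F) (htF : t ∈ F) (hs : 0 ≤ s) (hst : s < t)
    (ht : t ≤ T) : ∃ u v, IsConsecutive F u v ∧ s ≤ u ∧ v ≤ t ∧
      ω s u ≤ ω s t / 2 ∧ ω v t ≤ ω s t / 2 := by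
  have hnn := hω.nonneg s t hs hst.le ht
  set G := F.filter fun x => s ≤ x ∧ x < t ∧ ω s x ≤ ω s t / 2
  have hsG : s ∈ G := Finset.mem_filter.2
    ⟨hsF, le_rfl, hst, by rw [hω.self_eq_zero hs (hst.le.trans ht)]; positivity⟩
  set u := G.max' ⟨s, hsG⟩
  obtain ⟨huF, hsu, hut, hωu⟩ := Finset.mem_filter.1 (G.max'_mem ⟨s, hsG⟩)
  set H := F.filter (u < ·)
  have htH : t ∈ H := Finset.mem_filter.2 ⟨htF, hut⟩
  set v := H.min' ⟨t, htH⟩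
  obtain ⟨hvF, huv⟩ := Finset.mem_filter.1 (H.min'_mem ⟨t, htH⟩)
  have hvt : v ≤ t := H.min'_le t htH
  refine ⟨u, v, ⟨huF, hvF, huv, fun x hx hux => H.min'_le x (Finset.mem_filter.2 ⟨hx, hux⟩)⟩,
    hsu, hvt, hωu, ?_⟩
  rcases hvt.eq_or_lt with hvt' | hvt'
  · rw [hvt', hω.self_eq_zero (hs.trans hst.le) ht]
    positivity
  · have hωv : ω s t / 2 < ω s v := not_le.1 fun hle =>
      huv.not_ge (G.le_max' v (Finset.mem_filter.2 ⟨hvF, hsu.trans huv.le, hvt', hle⟩))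
    linarith [hω.superadd s v t hs (hsu.trans huv.le) hvt ht]

theorem card_filter_Icc_lt {α : Type*} [PartialOrder α] [DecidableLE α] {F : Finset α}
    {s t x y : α} (hs : s ∈ F) (ht : t ∈ F) (hst : s ≤ t) (hsx : s ≤ x) (hyt : y ≤ t)
    (hne : s < x ∨ y < t) : (F.filter fun r => x ≤ r ∧ r ≤ y).card
      < (F.filter fun r => s ≤ r ∧ r ≤ t).card := by
  refine Finset.card_lt_card ((Finset.ssubset_iff_of_subset ?_).2 ?_)
  · exact Finset.monotone_filter_right _ fun r _ hr => ⟨hsx.trans hr.1, hr.2.trans hyt⟩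
  · rcases hne with h | h
    · exact ⟨s, by simp [hs, hst], fun hmem => h.not_ge (Finset.mem_filter.1 hmem).2.1⟩
    · exact ⟨t, by simp [ht, hst], fun hmem => h.not_ge (Finset.mem_filter.1 hmem).2.2⟩

/-- The constant of the sewing lemma, the fixed point of `C ↦ 2 * (C * (1 / 2) ^ θ) + 2`. -/
def sewConst (θ : ℝ) : ℝ := 2 / (1 - 2 * (1 / 2 : ℝ) ^ θ)

theorem two_mul_half_rpow_lt_one {θ : ℝ} (hθ : 1 < θ) : 2 * (1 / 2 : ℝ) ^ θ < 1 := by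
  have h := Real.rpow_lt_rpow_of_exponent_gt (x := (1 / 2 : ℝ)) (by norm_num) (by norm_num) hθ
  rw [Real.rpow_one] at h
  linarith

theorem sewConst_pos {θ : ℝ} (hθ : 1 < θ) : 0 < sewConst θ :=
  div_pos two_pos (sub_pos.2 (two_mul_half_rpow_lt_one hθ))

theorem sewConst_eq {θ : ℝ} (hθ : 1 < θ) :
    2 * (sewConst θ * (1 / 2 : ℝ) ^ θ) + 2 = sewConst θ := by
  have h : 1 - 2 * (1 / 2 : ℝ) ^ θ ≠ 0 := (sub_pos.2 (two_mul_half_rpow_lt_one hθ)).ne'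
  rw [sewConst]
  generalize (1 / 2 : ℝ) ^ θ = x at h ⊢
  field_simp
  ring

section Sewing

variable {E : Type*} [NormedAddCommGroup E] {T K θ : ℝ} {ω : ℝ → ℝ → ℝ} {h : ℝ → ℝ → ℝ → E}

/-- Splitting at the consecutive points `u, v` where the control has dropped by half leaves two
subproblems with fewer points and, by superlinearity, a geometrically smaller bound. -/
theorem norm_le_of_isConsecutive_eq_zero {A : ℝ → ℝ → E} (hω : IsControl T ω) {a b : ℝ}
    (ha : 0 ≤ a) (hb : b ≤ T) (hθ : 1 < θ) (hK : 0 ≤ K)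
    (hh : ∀ s u t, a ≤ s → s ≤ u → u ≤ t → t ≤ b → ‖h s u t‖ ≤ K * ω s t ^ θ)
    (hA : ∀ s u t, a ≤ s → s ≤ u → u ≤ t → t ≤ b → A s t = A s u + A u t + h s u t)
    {F : Finset ℝ} (hF : ∀ u v, IsConsecutive F u v → a ≤ u → v ≤ b → A u v = 0)
    {s t : ℝ} (hsF : s ∈ F) (htF : t ∈ F) (has : a ≤ s) (hst : s ≤ t) (htb : t ≤ b) :
    ‖A s t‖ ≤ sewConst θ * K * ω s t ^ θ := by
  induction hn : (F.filter fun r => s ≤ r ∧ r ≤ t).card using Nat.strong_induction_on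
    generalizing s t with
  | _ n ih =>
  subst hn
  have hs := ha.trans has
  have ht := htb.trans hb
  rcases hst.eq_or_lt with rfl | hlt
  · have hself : A s s = -h s s s := eq_neg_of_add_eq_zero_left <| by
      simpa [add_assoc] using hA s s s has le_rfl le_rfl htb
    simpa [hself, hω.self_eq_zero hs ht, Real.zero_rpow (by linarith : θ ≠ 0)] using
      hh s s s has le_rfl le_rfl htb
  obtain ⟨u, v, huv, hsu, hvt, hωu, hωv⟩ :=
    hω.exists_isConsecutive_le_half hsF htF hs hlt ht
  have hsv := hsu.trans huv.lt.le
  have hut := huv.lt.le.trans hvt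
  have hnn := hω.nonneg s t hs hst ht
  have hC := sewConst_pos hθ
  have hhalf : ∀ x y, x ∈ F → y ∈ F → s ≤ x → x ≤ y → y ≤ t → (s < x ∨ y < t) →
      ω x y ≤ ω s t / 2 → ‖A x y‖ ≤ sewConst θ * K * ((1 / 2 : ℝ) ^ θ * ω s t ^ θ) := by
    intro x y hxF hyF hsx hxy hyt hne hle
    have hnn' := hω.nonneg x y (hs.trans hsx) hxy (hyt.trans ht)
    rw [← Real.mul_rpow (by norm_num) hnn]
    refine (ih _ (card_filter_Icc_lt hsF htF hst hsx hyt hne) hxF hyF (has.trans hsx) hxy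
      (hyt.trans htb) rfl).trans ?_
    gcongr
    linarith
  have hhsuv : ‖h s u v‖ ≤ K * ω s t ^ θ := by
    have hnn' := hω.nonneg s v hs hsv (hvt.trans ht)
    have hmono := hω.mono hs le_rfl hsv hvt ht
    exact (hh s u v has hsu huv.lt.le (hvt.trans htb)).trans (by gcongr)
  rw [hA s v t has hsv hvt htb, hA s u v has hsu huv.lt.le (hvt.trans htb),
    hF u v huv (has.trans hsu) (hvt.trans htb), add_zero]
  refine (norm_add_le_of_le (norm_add_le_of_le (norm_add_le_of_le
    (hhalf s u hsF huv.left_mem le_rfl hsu hut (.inr (huv.lt.trans_le hvt)) hωu) hhsuv)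
    (hhalf v t huv.right_mem htF hsv hvt le_rfl (.inl (hsu.trans_lt huv.lt)) hωv))
    (hh s v t has hsv hvt htb)).trans_eq ?_
  linear_combination K * ω s t ^ θ * sewConst_eq hθ

variable [ProperSpace E]

theorem exists_tendsto_ultrafilter_of_norm_le {ι : Type*} {L : Ultrafilter ι} {f : ι → E} {C : ℝ}
    (hf : ∀ᶠ i in L, ‖f i‖ ≤ C) : ∃ y, Tendsto f L (𝓝 y) := by
  have hball : ∀ᶠ i in L, f i ∈ Metric.closedBall 0 C :=
    hf.mono fun i hi => mem_closedBall_zero_iff.2 hi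
  obtain ⟨y, -, hy⟩ := (isCompact_closedBall (0 : E) C).ultrafilter_le_nhds
    (L.map f) (le_principal_iff.2 hball)
  exact ⟨y, hy⟩

/-- The sewn map is an ultrafilter limit, over the finite sets `F` of times, of the maps that vanish
on neighbours in `F`; the local form of the bound is what gives continuity later. -/
theorem exists_sewing (hω : IsControl T ω)
    (hcoc : ∀ s u v t, 0 ≤ s → s ≤ u → u ≤ v → v ≤ t → t ≤ T →
      h s u v + h s v t = h s u t + h u v t) (hθ : 1 < θ) (hK : 0 ≤ K)
    (hh : ∀ s u t, 0 ≤ s → s ≤ u → u ≤ t → t ≤ T → ‖h s u t‖ ≤ K * ω s t ^ θ) :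
    ∃ A : ℝ → ℝ → E,
      (∀ s u t, 0 ≤ s → s ≤ u → u ≤ t → t ≤ T → A s t = A s u + A u t + h s u t) ∧
      ∀ a b K' θ', 0 ≤ a → a ≤ b → b ≤ T → 1 < θ' → 0 ≤ K' →
        (∀ s u t, a ≤ s → s ≤ u → u ≤ t → t ≤ b → ‖h s u t‖ ≤ K' * ω s t ^ θ') →
        ‖A a b‖ ≤ sewConst θ' * K' * ω a b ^ θ' := by
  choose φ hφ using exists_sub_eq_of_isConsecutive (fun s t => h 0 s t)
  set A : Finset ℝ → ℝ → ℝ → E := fun F s t => φ F t - φ F s - h 0 s t with hA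
  have hA_add : ∀ F s u t, 0 ≤ s → s ≤ u → u ≤ t → t ≤ T →
      A F s t = A F s u + A F u t + h s u t := by
    intro F s u t hs hsu hut ht
    rw [eq_sub_of_add_eq' (hcoc 0 s u t le_rfl hs hsu hut ht).symm]
    simp only [hA]
    abel
  have hA_le : ∀ a b K' θ', 0 ≤ a → a ≤ b → b ≤ T → 1 < θ' → 0 ≤ K' →
      (∀ s u t, a ≤ s → s ≤ u → u ≤ t → t ≤ b → ‖h s u t‖ ≤ K' * ω s t ^ θ') →
      ∀ F : Finset ℝ, a ∈ F → b ∈ F → ‖A F a b‖ ≤ sewConst θ' * K' * ω a b ^ θ' :=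
    fun a b K' θ' ha hab hb hθ' hK' hh' F haF hbF =>
      norm_le_of_isConsecutive_eq_zero hω ha hb hθ' hK' hh'
        (fun s u t has hsu hut htb => hA_add F s u t (ha.trans has) hsu hut (htb.trans hb))
        (fun u v huv _ _ => sub_eq_zero.2 (hφ F u v huv)) haF hbF le_rfl hab le_rfl
  let L : Ultrafilter (Finset ℝ) := Ultrafilter.of atTop
  have hmem : ∀ x : ℝ, ∀ᶠ F : Finset ℝ in L, x ∈ F := fun x =>
    Ultrafilter.of_le atTop ((eventually_ge_atTop {x}).mono fun F hF => hF (by simp))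
  have hlim : ∀ s t, ∃ y, 0 ≤ s → s ≤ t → t ≤ T → Tendsto (fun F => A F s t) L (𝓝 y) := by
    intro s t
    by_cases hst : 0 ≤ s ∧ s ≤ t ∧ t ≤ T
    · obtain ⟨hs, hst, ht⟩ := hst
      obtain ⟨y, hy⟩ := exists_tendsto_ultrafilter_of_norm_le <|
        (hmem s).and (hmem t) |>.mono fun F hF => hA_le s t K θ hs hst ht hθ hK
          (fun s' u' t' h₁ h₂ h₃ h₄ => hh s' u' t' (hs.trans h₁) h₂ h₃ (h₄.trans ht)) F hF.1 hF.2
      exact ⟨y, fun _ _ _ => hy⟩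
    · exact ⟨0, fun hs hst' ht => absurd ⟨hs, hst', ht⟩ hst⟩
  choose B hB using hlim
  refine ⟨B, fun s u t hs hsu hut ht => ?_, fun a b K' θ' ha hab hb hθ' hK' hh' => ?_⟩
  · refine tendsto_nhds_unique (hB s t hs (hsu.trans hut) ht) (Tendsto.congr (fun F =>
      (hA_add F s u t hs hsu hut ht).symm) (((hB s u hs hsu (hut.trans ht)).add
        (hB u t (hs.trans hsu) hut ht)).add_const (h s u t)))
  · refine le_of_tendsto (hB a b ha hab hb).norm ?_
    filter_upwards [hmem a, hmem b] with F haF hbF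
    exact hA_le a b K' θ' ha hab hb hθ' hK' hh' F haF hbF

end Sewing

section SewingContinuity

variable {E : Type*} [NormedAddCommGroup E] {T K θ : ℝ} {ω : ℝ → ℝ → ℝ} {h : ℝ → ℝ → ℝ → E}
  {A : ℝ → ℝ → E}

/-- The set of ordered triples `s ≤ u ≤ t` in `[0, T]`, on which a cocycle lives. -/
def simplex₃ (T : ℝ) : Set (ℝ × ℝ × ℝ) := {x | 0 ≤ x.1 ∧ x.1 ≤ x.2.1 ∧ x.2.1 ≤ x.2.2 ∧ x.2.2 ≤ T}

theorem isCompact_simplex₃ (T : ℝ) : IsCompact (simplex₃ T) := by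
  have hmid : Continuous fun x : ℝ × ℝ × ℝ => x.2.1 := by fun_prop
  have hlast : Continuous fun x : ℝ × ℝ × ℝ => x.2.2 := by fun_prop
  have hclosed : IsClosed (simplex₃ T) :=
    (isClosed_le continuous_const continuous_fst).inter
      ((isClosed_le continuous_fst hmid).inter
        ((isClosed_le hmid hlast).inter (isClosed_le hlast continuous_const)))
  refine (isCompact_Icc.prod (isCompact_Icc.prod isCompact_Icc)).of_isClosed_subset hclosed
    fun x ⟨hs, hsu, hut, ht⟩ => (⟨⟨hs, hsu.trans (hut.trans ht)⟩,
      ⟨hs.trans hsu, hut.trans ht⟩, hs.trans (hsu.trans hut), ht⟩ :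
        x ∈ Set.Icc 0 T ×ˢ Set.Icc 0 T ×ˢ Set.Icc 0 T)

theorem exists_norm_le_of_continuousOn_simplex₃
    (hcont : ContinuousOn (fun x : ℝ × ℝ × ℝ => h x.1 x.2.1 x.2.2) (simplex₃ T))
    (hself : ∀ s, 0 ≤ s → s ≤ T → h s s s = 0) {ε : ℝ} (hε : 0 < ε) :
    ∃ δ > 0, ∀ s u t, 0 ≤ s → s ≤ u → u ≤ t → t ≤ T → t - s < δ → ‖h s u t‖ ≤ ε := by
  obtain ⟨δ, hδ, H⟩ := Metric.uniformContinuousOn_iff.1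
    ((isCompact_simplex₃ T).uniformContinuousOn_of_continuous hcont) ε hε
  refine ⟨δ, hδ, fun s u t hs hsu hut ht hlt => ?_⟩
  have hsT := hsu.trans (hut.trans ht)
  have hdist : dist (s, u, t) (s, s, s) < δ := by
    simp only [Prod.dist_eq, dist_self, Real.dist_eq, abs_of_nonneg (sub_nonneg.2 hsu),
      abs_of_nonneg (sub_nonneg.2 (hsu.trans hut)), max_lt_iff]
    exact ⟨hδ, by linarith, hlt⟩
  simpa [hself s hs hsT] using
    (H (s, u, t) ⟨hs, hsu, hut, ht⟩ (s, s, s) ⟨hs, le_rfl, le_rfl, hsT⟩ hdist).le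

/-- Near the diagonal the cocycle obeys a bound with a smaller exponent and a small constant, which
the local form of the sewing bound passes on to `A`. -/
theorem SmallDiag.of_sewing (hω : IsControl T ω) (hθ : 1 < θ) (hK : 0 ≤ K)
    (hh : ∀ s u t, 0 ≤ s → s ≤ u → u ≤ t → t ≤ T → ‖h s u t‖ ≤ K * ω s t ^ θ)
    (hsmall : ∀ ε > 0, ∃ δ > 0, ∀ s u t, 0 ≤ s → s ≤ u → u ≤ t → t ≤ T → t - s < δ →
      ‖h s u t‖ ≤ ε)
    (hA : ∀ a b K' θ', 0 ≤ a → a ≤ b → b ≤ T → 1 < θ' → 0 ≤ K' →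
      (∀ s u t, a ≤ s → s ≤ u → u ≤ t → t ≤ b → ‖h s u t‖ ≤ K' * ω s t ^ θ') →
      ‖A a b‖ ≤ sewConst θ' * K' * ω a b ^ θ') : SmallDiag T A := by
  intro ε hε
  obtain ⟨θ', hθ', hθθ'⟩ := exists_between hθ
  have hC := sewConst_pos hθ'
  set M := |ω 0 T| ^ θ'
  have hden : 0 < sewConst θ' * (M + 1) := by positivity
  set η := ε / (sewConst θ' * (M + 1)) with hη
  obtain ⟨ε', hε', Hε⟩ := exists_forall_le_mul_rpow hK (by linarith : 0 ≤ θ') hθθ' (η := η)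
    (by positivity)
  obtain ⟨δ, hδ, Hδ⟩ := hsmall ε' hε'
  refine ⟨δ, hδ, fun a b ha hab hb hlt => ?_⟩
  have hlocal : ∀ s u t, a ≤ s → s ≤ u → u ≤ t → t ≤ b → ‖h s u t‖ ≤ η * ω s t ^ θ' := by
    intro s u t has hsu hut htb
    have hs := ha.trans has
    have ht := htb.trans hb
    exact Hε _ _ (hω.nonneg s t hs (hsu.trans hut) ht) (hh s u t hs hsu hut ht)
      (Hδ s u t hs hsu hut ht (by linarith))
  have hωM : ω a b ^ θ' ≤ M + 1 := by
    have hle : ω a b ^ θ' ≤ M := Real.rpow_le_rpow (hω.nonneg a b ha hab hb)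
      ((hω.mono le_rfl ha hab hb le_rfl).trans (le_abs_self _)) (by linarith)
    linarith
  calc ‖A a b‖ ≤ sewConst θ' * η * ω a b ^ θ' :=
        hA a b η θ' ha hab hb hθ' (by positivity) hlocal
    _ ≤ sewConst θ' * η * (M + 1) := by gcongr
    _ = ε := by rw [hη, mul_right_comm, mul_div_cancel₀ _ hden.ne']

theorem SmallDiag.add {B : ℝ → ℝ → E} (hA : SmallDiag T A) (hB : SmallDiag T B) :
    SmallDiag T (fun s t => A s t + B s t) := by
  intro ε hε
  obtain ⟨δ, hδ, HA⟩ := hA (ε / 2) (by positivity)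
  obtain ⟨δ', hδ', HB⟩ := hB (ε / 2) (by positivity)
  refine ⟨min δ δ', lt_min hδ hδ', fun s t hs hst ht hlt => ?_⟩
  rw [← add_halves ε]
  exact norm_add_le_of_le (HA s t hs hst ht (hlt.trans_le (min_le_left _ _)))
    (HB s t hs hst ht (hlt.trans_le (min_le_right _ _)))

theorem SmallDiag.continuousOn_Icc {f : ℝ → E} (hf : SmallDiag T fun s t => f t - f s) :
    ContinuousOn f (Set.Icc 0 T) := by
  refine Metric.continuousOn_iff.2 fun b hb ε hε => ?_
  obtain ⟨δ, hδ, H⟩ := hf (ε / 2) (by positivity)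
  refine ⟨δ, hδ, fun a ha hab => lt_of_le_of_lt ?_ (half_lt_self hε)⟩
  rw [Real.dist_eq] at hab
  rcases le_total a b with h | h
  · rw [dist_comm, dist_eq_norm]
    exact H a b ha.1 h hb.2 ((le_abs_self _).trans_lt ((abs_sub_comm b a).trans_lt hab))
  · rw [dist_eq_norm]
    exact H b a hb.1 h ha.2 ((le_abs_self _).trans_lt hab)

theorem continuousOn_simplex_of_additive_defect
    (hadd : ∀ s t, 0 ≤ s → s ≤ t → t ≤ T → A 0 t = A 0 s + A s t + h 0 s t)
    (hAsmall : SmallDiag T A)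
    (hcont : ContinuousOn (fun x : ℝ × ℝ => h 0 x.1 x.2) (simplex T))
    (hself : ∀ s, 0 ≤ s → s ≤ T → h 0 s s = 0) :
    ContinuousOn (fun x : ℝ × ℝ => A x.1 x.2) (simplex T) := by
  have hpath : ContinuousOn (fun t => A 0 t) (Set.Icc 0 T) := by
    refine SmallDiag.continuousOn_Icc fun ε hε => ?_
    obtain ⟨δ, hδ, H⟩ := hAsmall.add (SmallDiag.of_continuousOn hcont hself) ε hε
    refine ⟨δ, hδ, fun s t hs hst ht hlt => ?_⟩
    simp only [hadd s t hs hst ht, add_assoc, add_sub_cancel_left]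
    exact H s t hs hst ht hlt
  have hdiff : ContinuousOn (fun x : ℝ × ℝ => A 0 x.2 - A 0 x.1 - h 0 x.1 x.2) (simplex T) :=
    ((hpath.comp continuousOn_snd fun x hx => ⟨hx.1.trans hx.2.1, hx.2.2⟩).sub
      (hpath.comp continuousOn_fst fun x hx => ⟨hx.1, hx.2.1.trans hx.2.2⟩)).sub hcont
  refine hdiff.congr fun x hx => ?_
  simp only [hadd x.1 x.2 hx.1 hx.2.1 hx.2.2]
  abel

theorem sewing [ProperSpace E] (hω : IsControl T ω)
    (hcoc : ∀ s u v t, 0 ≤ s → s ≤ u → u ≤ v → v ≤ t → t ≤ T →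
      h s u v + h s v t = h s u t + h u v t) (hθ : 1 < θ) (hK : 0 ≤ K)
    (hh : ∀ s u t, 0 ≤ s → s ≤ u → u ≤ t → t ≤ T → ‖h s u t‖ ≤ K * ω s t ^ θ)
    (hcont : ContinuousOn (fun x : ℝ × ℝ × ℝ => h x.1 x.2.1 x.2.2) (simplex₃ T)) :
    ∃ A : ℝ → ℝ → E,
      (∀ s u t, 0 ≤ s → s ≤ u → u ≤ t → t ≤ T → A s t = A s u + A u t + h s u t) ∧
      PowBound T ω θ A ∧ ContinuousOn (fun x : ℝ × ℝ => A x.1 x.2) (simplex T) := by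
  obtain ⟨A, hA, hAb⟩ := exists_sewing hω hcoc hθ hK hh
  have hbound : PowBound T ω θ A :=
    ⟨_, mul_nonneg (sewConst_pos hθ).le hK, fun s t hs hst ht => hAb s t K θ hs hst ht hθ hK
      fun s' u' t' h₁ h₂ h₃ h₄ => hh s' u' t' (hs.trans h₁) h₂ h₃ (h₄.trans ht)⟩
  have hself : ∀ s, 0 ≤ s → s ≤ T → h s s s = 0 := fun s hs hT => by
    simpa [hω.self_eq_zero hs hT, Real.zero_rpow (by linarith : θ ≠ 0)] using
      hh s s s hs le_rfl le_rfl hT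
  have hself₀ : ∀ s, 0 ≤ s → s ≤ T → h 0 s s = 0 := fun s hs hT => by
    simpa [hself s hs hT] using hcoc 0 s s s le_rfl hs le_rfl le_rfl hT
  refine ⟨A, hA, hbound, continuousOn_simplex_of_additive_defect
    (fun s t hs => hA 0 s t le_rfl hs) (.of_sewing hω hθ hK hh (fun ε hε =>
      exists_norm_le_of_continuousOn_simplex₃ hcont hself hε) hAb) ?_ hself₀⟩
  exact hcont.comp (f := fun x : ℝ × ℝ => ((0 : ℝ), x.1, x.2)) (by fun_prop)
    fun x hx => ⟨le_rfl, hx.1, hx.2.1, hx.2.2⟩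

end SewingContinuity

/-! ### Controls and finite variation -/

theorem exists_control {T : ℝ} {f : ℝ → ℝ → ℝ} (hf : ∀ s t, 0 ≤ f s t) {B : ℝ}
    (hB : ∀ P : Partition 0 T, P.sum f ≤ B) :
    ∃ ω, IsControl T ω ∧ ∀ s t, 0 ≤ s → s < t → t ≤ T → f s t ≤ ω s t := by
  have hnn : ∀ {s t} (P : Partition s t), 0 ≤ P.sum f := fun P =>
    Finset.sum_nonneg fun i _ => hf _ _
  have hbdd : ∀ s t, 0 ≤ s → t ≤ T → BddAbove (Set.range fun P : Partition s t => P.sum f) := by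
    refine fun s t hs ht => ⟨B, Set.forall_mem_range.2 fun P => ?_⟩
    obtain ⟨P₀⟩ := Partition.nonempty hs
    obtain ⟨P₁⟩ := Partition.nonempty ht
    obtain ⟨Q, hQ⟩ := P.exists_append (M := ℝ) P₁
    obtain ⟨Q', hQ'⟩ := P₀.exists_append (M := ℝ) Q
    linarith [hB Q', hQ' f, hQ f, hnn P₀, hnn P₁]
  refine ⟨fun s t => ⨆ P : Partition s t, P.sum f, ⟨fun s t _ _ _ => ?_, ?_⟩, ?_⟩
  · exact Real.iSup_nonneg fun P => hnn P
  · intro s u t hs hsu hut ht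
    have := Partition.nonempty hsu
    have := Partition.nonempty hut
    refine ciSup_add_ciSup_le fun P R => ?_
    obtain ⟨Q, hQ⟩ := P.exists_append (M := ℝ) R
    exact (hQ f).symm.trans_le (le_ciSup (hbdd s t hs ht) Q)
  · intro s t hs hst ht
    refine le_of_eq_of_le ?_ (le_ciSup (hbdd s t hs ht) (.cons hst (.refl t)))
    rw [Partition.sum_cons, Partition.sum_refl, add_zero]

section Variation

variable {E : Type*} [NormedAddCommGroup E] {r T : ℝ} {A : ℝ → ℝ → E}

theorem sum_enorm_rpow (hr : 0 ≤ r) {s t : ℝ} (P : Partition s t) :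
    (P.sum fun u v => ‖A u v‖ₑ ^ r) = ENNReal.ofReal (P.sum fun u v => ‖A u v‖ ^ r) := by
  rw [Partition.sum, Partition.sum, ENNReal.ofReal_sum_of_nonneg fun i _ => by positivity]
  refine Finset.sum_congr rfl fun i _ => ?_
  rw [← ofReal_norm, ENNReal.ofReal_rpow_of_nonneg (norm_nonneg _) hr]

theorem variation_lt_top_iff (hr : 0 < r) {s t : ℝ} :
    variation r A s t < ⊤ ↔ ∃ B, ∀ P : Partition s t, (P.sum fun u v => ‖A u v‖ ^ r) ≤ B := by
  have hsum : ∀ P : Partition s t, ∑ i : Fin P.n, ‖A (P.pt i.castSucc) (P.pt i.succ)‖ₑ ^ r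
      = ENNReal.ofReal (P.sum fun u v => ‖A u v‖ ^ r) := fun P => sum_enorm_rpow hr.le P
  simp only [variation, ENNReal.rpow_lt_top_iff_of_pos (one_div_pos.2 hr), hsum]
  refine ⟨fun h => ⟨_, fun P => (ENNReal.ofReal_le_iff_le_toReal h.ne).1 (le_iSup (fun P :
    Partition s t => ENNReal.ofReal (P.sum fun u v => ‖A u v‖ ^ r)) P)⟩, fun ⟨B, hB⟩ => ?_⟩
  exact (iSup_le fun P => ENNReal.ofReal_le_ofReal (hB P)).trans_lt ENNReal.ofReal_lt_top

theorem exists_control_of_variation_lt_top (hr : 0 < r) (hA : variation r A 0 T < ⊤)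
    (hself : ∀ s, 0 ≤ s → s ≤ T → A s s = 0) : ∃ ω, IsControl T ω ∧ PowBound T ω (1 / r) A := by
  obtain ⟨B, hB⟩ := (variation_lt_top_iff hr).1 hA
  obtain ⟨ω, hω, hle⟩ := exists_control (fun s t => by positivity) hB
  refine ⟨ω, hω, 1, zero_le_one, fun s t hs hst ht => ?_⟩
  rw [one_mul]
  rcases hst.eq_or_lt with rfl | hlt
  · rw [hself s hs ht, norm_zero]
    exact Real.rpow_nonneg (hω.nonneg s s hs hst ht) _
  · rw [one_div, Real.le_rpow_inv_iff_of_pos (norm_nonneg _) (hω.nonneg s t hs hst ht) hr]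
    exact hle s t hs hlt ht

theorem PowBound.variation_lt_top {ω : ℝ → ℝ → ℝ} (hω : IsControl T ω) (hT : 0 ≤ T) (hr : 0 < r)
    (hA : PowBound T ω (1 / r) A) : variation r A 0 T < ⊤ := by
  obtain ⟨C, hC, hb⟩ := hA
  refine (variation_lt_top_iff hr).2 ⟨C ^ r * ω 0 T, fun P => ?_⟩
  calc (P.sum fun u v => ‖A u v‖ ^ r)
      ≤ P.sum fun u v => C ^ r * ω u v := P.sum_le_sum fun u v hu huv hv _ => by
        have hw := hω.nonneg u v hu huv.le hv
        refine (Real.rpow_le_rpow (norm_nonneg _) (hb u v hu huv.le hv) hr.le).trans_eq ?_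
        rw [Real.mul_rpow hC (by positivity), one_div, Real.rpow_inv_rpow hw hr.ne']
    _ = C ^ r * P.sum ω := (Finset.mul_sum _ _ _).symm
    _ ≤ C ^ r * ω 0 T := by gcongr; exact hω.sum_le le_rfl hT le_rfl P

end Variation

section EuclideanSpace

variable {ι : Type*} [Fintype ι] {T θ : ℝ} {ω : ℝ → ℝ → ℝ} {A : ℝ → ℝ → EuclideanSpace ℝ ι}

theorem PowBound.apply (hA : PowBound T ω θ A) (i : ι) : PowBound T ω θ (fun s t => A s t i) := by
  obtain ⟨C, hC, hb⟩ := hA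
  exact ⟨C, hC, fun s t hs hst ht => (PiLp.norm_apply_le (A s t) i).trans (hb s t hs hst ht)⟩

theorem PowBound.of_apply (hA : ∀ i, PowBound T ω θ (fun s t => A s t i)) : PowBound T ω θ A := by
  choose C hC hb using hA
  refine ⟨∑ i, C i, Finset.sum_nonneg fun i _ => hC i, fun s t hs hst ht => ?_⟩
  classical
  rw [← (EuclideanSpace.basisFun ι ℝ).sum_repr (A s t), Finset.sum_mul]
  refine norm_sum_le_of_le _ fun i _ => ?_
  simpa [norm_smul] using hb i s t hs hst ht

end EuclideanSpace

/-! ### Tensor series -/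

namespace TSeries

variable {ι : Type*} {a a' b b' c : TSeries ι} {w : List ι}

theorem tensor_nil (a b : TSeries ι) : a.tensor b [] = a [] * b [] := by
  simp [tensor]

theorem tensor_cons (a b : TSeries ι) (i : ι) (w : List ι) :
    a.tensor b (i :: w) = a [] * b (i :: w) + tensor (fun v => a (i :: v)) b w := by
  rw [tensor, List.length_cons, Finset.sum_range_succ', add_comm]
  simp [tensor]

theorem tensor_add_left (a a' b : TSeries ι) : (a + a').tensor b = a.tensor b + a'.tensor b := by
  funext w
  simp only [tensor, Pi.add_apply, add_mul, Finset.sum_add_distrib]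

theorem tensor_smul_left (r : ℝ) (a b : TSeries ι) : (r • a).tensor b = r • a.tensor b := by
  funext w
  simp only [tensor, Pi.smul_apply, smul_eq_mul, Finset.mul_sum, mul_assoc]

theorem tensor_assoc (a b c : TSeries ι) : (a.tensor b).tensor c = a.tensor (b.tensor c) := by
  funext w
  induction w generalizing a with
  | nil => simp only [tensor_nil, mul_assoc]
  | cons i w ih =>
    have htail : (fun v => a.tensor b (i :: v))
        = a [] • (fun v => b (i :: v)) + tensor (fun v => a (i :: v)) b :=
      funext fun v => tensor_cons a b i v
    rw [tensor_cons, htail, tensor_add_left, tensor_smul_left, Pi.add_apply, ih,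
      tensor_cons a, tensor_cons b, tensor_nil, Pi.smul_apply, smul_eq_mul]
    ring

/-- The part of the product coming from splittings of a word into two proper pieces. -/
def mid (a b : TSeries ι) (w : List ι) : ℝ :=
  ∑ k ∈ Finset.Ico 1 w.length, a (w.take k) * b (w.drop k)

theorem tensor_eq_mid (a b : TSeries ι) (hw : w ≠ []) :
    a.tensor b w = a [] * b w + a.mid b w + a w * b [] := by
  have hlen : 0 < w.length := List.length_pos_iff.2 hw
  rw [tensor, mid, Finset.sum_range_succ, Finset.range_eq_Ico,
    Finset.sum_eq_sum_Ico_succ_bot hlen]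
  simp

theorem mid_congr (ha : ∀ k ∈ Finset.Ico 1 w.length, a (w.take k) = a' (w.take k))
    (hb : ∀ k ∈ Finset.Ico 1 w.length, b (w.drop k) = b' (w.drop k)) :
    a.mid b w = a'.mid b' w :=
  Finset.sum_congr rfl fun k hk => by rw [ha k hk, hb k hk]

theorem mid_add_mid (ha : a [] = 1) (hb : b [] = 1) (hc : c [] = 1) (hw : w ≠ []) :
    a.mid b w + (a.tensor b).mid c w = a.mid (b.tensor c) w + b.mid c w := by
  have h := congrFun (tensor_assoc a b c) w
  rw [tensor_eq_mid _ c hw, tensor_eq_mid a (b.tensor c) hw, tensor_eq_mid a b hw,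
    tensor_eq_mid b c hw, tensor_nil, tensor_nil, ha, hb, hc] at h
  linarith

theorem eq_zero_of_tensor_self (ha : a [] = 1) (h : a.tensor a = a) (hw : w ≠ []) : a w = 0 := by
  induction hlen : w.length using Nat.strong_induction_on generalizing w with
  | _ n ih =>
    have hmid : a.mid a w = 0 := Finset.sum_eq_zero fun k hk => by
      rw [Finset.mem_Ico] at hk
      have htake : (w.take k).length < n := by rw [List.length_take]; omega
      have hne : w.take k ≠ [] := List.ne_nil_of_length_pos (by rw [List.length_take]; omega)
      rw [ih _ htake hne rfl, zero_mul]
    have hsplit := tensor_eq_mid a a hw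
    rw [h, ha, hmid] at hsplit
    linarith

end TSeries

/-! ### Words and their weights -/

section Weight

variable {ι : Type*} {wt : ι → ℕ}

/-- The weight of a word, the sum of the weights `wt` of its letters: the component of a
multiplicative functional indexed by a word `w` is to be of size `ω ^ (weight wt w / p)`. -/
def weight (wt : ι → ℕ) (w : List ι) : ℕ := (w.map wt).sum

theorem weight_nil (wt : ι → ℕ) : weight wt [] = 0 := rfl

theorem weight_cons (wt : ι → ℕ) (i : ι) (w : List ι) :
    weight wt (i :: w) = wt i + weight wt w := by simp [weight]

theorem weight_append (wt : ι → ℕ) (v w : List ι) :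
    weight wt (v ++ w) = weight wt v + weight wt w := by simp [weight]

theorem weight_reverse (wt : ι → ℕ) (w : List ι) : weight wt w.reverse = weight wt w := by
  simp [weight, List.sum_reverse]

theorem weight_take_add_weight_drop (wt : ι → ℕ) (w : List ι) (k : ℕ) :
    weight wt (w.take k) + weight wt (w.drop k) = weight wt w := by
  rw [← weight_append, List.take_append_drop]

theorem length_le_weight (hwt : ∀ i, 1 ≤ wt i) (w : List ι) : w.length ≤ weight wt w := by
  simpa [weight] using List.card_nsmul_le_sum (w.map wt) 1 (by simpa using fun i _ => hwt i)

theorem weight_take_drop_lt (hwt : ∀ i, 1 ≤ wt i) {w : List ι} {k : ℕ}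
    (hk : k ∈ Finset.Ico 1 w.length) :
    weight wt (w.take k) < weight wt w ∧ weight wt (w.drop k) < weight wt w := by
  have hsplit := weight_take_add_weight_drop wt w k
  have htake := length_le_weight hwt (w.take k)
  have hdrop := length_le_weight hwt (w.drop k)
  simp only [Finset.mem_Ico, List.length_take, List.length_drop] at hk htake hdrop
  omega

end Weight

/-! ### Extension of multiplicative functionals -/

/-- A continuous functional, multiplicative and with the homogeneity prescribed by `wt` on the words
of weight at most `n`; its values on heavier words are irrelevant. -/
structure IsWeightedFunctional {ι : Type*} (wt : ι → ℕ) (p T : ℝ) (ω : ℝ → ℝ → ℝ) (n : ℕ)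
    (S : ℝ → ℝ → TSeries ι) : Prop where
  nil : ∀ s t, 0 ≤ s → s ≤ t → t ≤ T → S s t [] = 1
  chen : ∀ w, weight wt w ≤ n → ∀ s u t, 0 ≤ s → s ≤ u → u ≤ t → t ≤ T →
    (S s u).tensor (S u t) w = S s t w
  bound : ∀ w, weight wt w ≤ n → PowBound T ω (weight wt w / p) (fun s t => S s t w)
  continuousOn : ∀ w, weight wt w ≤ n → ContinuousOn (fun x : ℝ × ℝ => S x.1 x.2 w) (simplex T)

namespace IsWeightedFunctional

variable {ι : Type*} {wt : ι → ℕ} {p T : ℝ} {ω : ℝ → ℝ → ℝ} {n : ℕ} {S S' : ℝ → ℝ → TSeries ι}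

theorem congr (hS : IsWeightedFunctional wt p T ω n S)
    (h : ∀ s t w, weight wt w ≤ n → S' s t w = S s t w) :
    IsWeightedFunctional wt p T ω n S' where
  nil s t hs hst ht := (h s t [] (Nat.zero_le n)).trans (hS.nil s t hs hst ht)
  chen w hw s u t hs hsu hut ht := by
    rw [h s t w hw, ← hS.chen w hw s u t hs hsu hut ht]
    refine Finset.sum_congr rfl fun k _ => ?_
    have hsplit := weight_take_add_weight_drop wt w k
    rw [h _ _ _ (by omega), h _ _ _ (by omega)]
  bound w hw := (hS.bound w hw).congr fun s t _ _ _ => h s t w hw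
  continuousOn w hw := (hS.continuousOn w hw).congr fun x _ => h x.1 x.2 w hw

theorem mono {m : ℕ} (hmn : m ≤ n) (hS : IsWeightedFunctional wt p T ω n S) :
    IsWeightedFunctional wt p T ω m S :=
  ⟨hS.nil, fun w hw => hS.chen w (hw.trans hmn), fun w hw => hS.bound w (hw.trans hmn),
    fun w hw => hS.continuousOn w (hw.trans hmn)⟩

section NextComponent

variable {w : List ι}

theorem mid_add_mid (hwt : ∀ i, 1 ≤ wt i) (hS : IsWeightedFunctional wt p T ω n S)
    (hw : weight wt w = n + 1) {s u v t : ℝ} (hs : 0 ≤ s) (hsu : s ≤ u) (huv : u ≤ v)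
    (hvt : v ≤ t) (ht : t ≤ T) :
    (S s u).mid (S u v) w + (S s v).mid (S v t) w
      = (S s u).mid (S u t) w + (S u v).mid (S v t) w := by
  have hne : w ≠ [] := by rintro rfl; simp [weight_nil] at hw
  have hu := hs.trans hsu
  have hvT := hvt.trans ht
  have hleft : (S s v).mid (S v t) w = ((S s u).tensor (S u v)).mid (S v t) w :=
    TSeries.mid_congr (fun k hk => by
      have := weight_take_drop_lt hwt hk
      rw [hS.chen _ (by omega) s u v hs hsu huv hvT]) fun _ _ => rfl
  have hright : (S s u).mid (S u t) w = (S s u).mid ((S u v).tensor (S v t)) w :=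
    TSeries.mid_congr (fun _ _ => rfl) fun k hk => by
      have := weight_take_drop_lt hwt hk
      rw [hS.chen _ (by omega) u v t hu huv hvt ht]
  rw [hleft, hright]
  exact TSeries.mid_add_mid (hS.nil s u hs hsu (huv.trans hvT)) (hS.nil u v hu huv hvT)
    (hS.nil v t (hu.trans huv) hvt ht) hne

theorem exists_norm_mid_le (hwt : ∀ i, 1 ≤ wt i) (hp : 0 < p) (hω : IsControl T ω)
    (hS : IsWeightedFunctional wt p T ω n S) (hw : weight wt w = n + 1) :
    ∃ K, 0 ≤ K ∧ ∀ s u t, 0 ≤ s → s ≤ u → u ≤ t → t ≤ T →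
      ‖(S s u).mid (S u t) w‖ ≤ K * ω s t ^ ((weight wt w : ℝ) / p) := by
  have hterm : ∀ k ∈ Finset.Ico 1 w.length, ∃ K, 0 ≤ K ∧ ∀ s u t, 0 ≤ s → s ≤ u → u ≤ t → t ≤ T →
      ‖S s u (w.take k) * S u t (w.drop k)‖ ≤ K * ω s t ^ ((weight wt w : ℝ) / p) := by
    intro k hk
    have := weight_take_drop_lt hwt hk
    rw [← weight_take_add_weight_drop wt w k, Nat.cast_add, add_div]
    exact (hS.bound _ (by omega)).exists_norm_mul_le hω (by positivity) (by positivity)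
      (hS.bound _ (by omega))
  choose! K hK hle using hterm
  refine ⟨∑ k ∈ Finset.Ico 1 w.length, K k, Finset.sum_nonneg hK, fun s u t hs hsu hut ht => ?_⟩
  rw [Finset.sum_mul]
  exact norm_sum_le_of_le _ fun k hk => hle k hk s u t hs hsu hut ht

theorem continuousOn_mid (hwt : ∀ i, 1 ≤ wt i) (hS : IsWeightedFunctional wt p T ω n S)
    (hw : weight wt w = n + 1) :
    ContinuousOn (fun x : ℝ × ℝ × ℝ => (S x.1 x.2.1).mid (S x.2.1 x.2.2) w) (simplex₃ T) := by
  refine continuousOn_finsetSum _ fun k hk => ?_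
  have := weight_take_drop_lt hwt hk
  refine ((hS.continuousOn (w.take k) (by omega)).comp (f := fun x : ℝ × ℝ × ℝ => (x.1, x.2.1))
    (by fun_prop) ?_).mul ((hS.continuousOn (w.drop k) (by omega)).comp
      (f := fun x : ℝ × ℝ × ℝ => (x.2.1, x.2.2)) (by fun_prop) ?_)
  · exact fun x hx => ⟨hx.1, hx.2.1, hx.2.2.1.trans hx.2.2.2⟩
  · exact fun x hx => ⟨hx.1.trans hx.2.1, hx.2.2.1, hx.2.2.2⟩

theorem exists_component (hwt : ∀ i, 1 ≤ wt i) (hp : 0 < p) (hω : IsControl T ω) (hn : p < n + 1)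
    (hS : IsWeightedFunctional wt p T ω n S) (hw : weight wt w = n + 1) :
    ∃ A : ℝ → ℝ → ℝ,
      (∀ s u t, 0 ≤ s → s ≤ u → u ≤ t → t ≤ T →
        A s t = A s u + A u t + (S s u).mid (S u t) w) ∧
      PowBound T ω (weight wt w / p) A ∧
      ContinuousOn (fun x : ℝ × ℝ => A x.1 x.2) (simplex T) := by
  have hθ : 1 < (weight wt w : ℝ) / p := by
    rw [one_lt_div hp, hw]
    exact_mod_cast hn
  obtain ⟨K, hK, hle⟩ := hS.exists_norm_mid_le hwt hp hω hw
  exact sewing hω (fun _ _ _ _ => hS.mid_add_mid hwt hw) hθ hK hle (hS.continuousOn_mid hwt hw)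

end NextComponent

theorem exists_succ (hwt : ∀ i, 1 ≤ wt i) (hp : 0 < p) (hω : IsControl T ω) (hn : p < n + 1)
    (hS : IsWeightedFunctional wt p T ω n S) :
    ∃ S', IsWeightedFunctional wt p T ω (n + 1) S' ∧
      ∀ s t w, weight wt w ≤ n → S' s t w = S s t w := by
  classical
  choose! A hAadd hAbound hAcont using
    fun w (hw : weight wt w = n + 1) => hS.exists_component hwt hp hω hn hw
  set S' : ℝ → ℝ → TSeries ι := fun s t w =>
    if weight wt w = n + 1 then A w s t else S s t w
  have hlow : ∀ s t w, weight wt w ≤ n → S' s t w = S s t w := fun s t w hw => if_neg (by omega)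
  have htop : ∀ s t w, weight wt w = n + 1 → S' s t w = A w s t := fun s t w hw => if_pos hw
  have hS' := hS.congr hlow
  refine ⟨S', ⟨hS'.nil, fun w hw => ?_, fun w hw => ?_, fun w hw => ?_⟩, hlow⟩
  all_goals rcases Nat.le_succ_iff.1 hw with hw | hw
  · exact hS'.chen w hw
  · intro s u t hs hsu hut ht
    have hne : w ≠ [] := by rintro rfl; simp [weight_nil] at hw
    have hmid : (S' s u).mid (S' u t) w = (S s u).mid (S u t) w :=
      TSeries.mid_congr
        (fun k hk => hlow _ _ _ (by have := weight_take_drop_lt hwt hk; omega))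
        (fun k hk => hlow _ _ _ (by have := weight_take_drop_lt hwt hk; omega))
    rw [TSeries.tensor_eq_mid _ _ hne, hmid, hS'.nil s u hs hsu (hut.trans ht),
      hS'.nil u t (hs.trans hsu) hut ht, htop _ _ _ hw, htop _ _ _ hw, htop _ _ _ hw,
      hAadd w hw s u t hs hsu hut ht]
    ring
  · exact hS'.bound w hw
  · exact (hAbound w hw).congr fun s t _ _ _ => htop s t w hw
  · exact hS'.continuousOn w hw
  · exact (hAcont w hw).congr fun x _ => htop x.1 x.2 w hw

theorem exists_extension (hwt : ∀ i, 1 ≤ wt i) (hp : 0 < p) (hω : IsControl T ω) (hn : p < n + 1)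
    (hS : IsWeightedFunctional wt p T ω n S) :
    ∃ S', (∀ m, IsWeightedFunctional wt p T ω m S') ∧
      ∀ s t w, weight wt w ≤ n → S' s t w = S s t w := by
  have hstep : ∀ k (R : {R // IsWeightedFunctional wt p T ω (n + k) R}),
      ∃ R' : {R // IsWeightedFunctional wt p T ω (n + (k + 1)) R},
        ∀ s t w, weight wt w ≤ n + k → R'.1 s t w = R.1 s t w := by
    rintro k ⟨R, hR⟩
    obtain ⟨R', hR', h⟩ :=
      hR.exists_succ hwt hp hω (by push_cast; linarith [k.cast_nonneg (α := ℝ)])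
    exact ⟨⟨R', hR'⟩, h⟩
  choose next hnext using hstep
  let ext : ∀ k, {R // IsWeightedFunctional wt p T ω (n + k) R} := fun k =>
    Nat.rec ⟨S, hS⟩ (fun k R => next k R) k
  have hext : ∀ k j, k ≤ j → ∀ s t w, weight wt w ≤ n + k →
      (ext j).1 s t w = (ext k).1 s t w := by
    intro k j hkj
    induction j, hkj using Nat.le_induction with
    | base => exact fun _ _ _ _ => rfl
    | succ j hkj ih =>
      exact fun s t w hw => (hnext j (ext j) s t w (by omega)).trans (ih s t w hw)
  refine ⟨fun s t w => (ext (weight wt w)).1 s t w, fun m => ?_, fun s t w hw => ?_⟩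
  · exact ((ext m).2.mono (Nat.le_add_left m n)).congr fun s t w hw =>
      (hext _ m hw s t w (Nat.le_add_left _ n)).symm
  · exact hext 0 _ (Nat.zero_le _) s t w hw

end IsWeightedFunctional

/-! ### Uniqueness of Lyons' extension -/

namespace IsLyonsExtension

variable {ι : Type*} [Fintype ι] {p T : ℝ} {X : ℝ → EuclideanSpace ℝ ι}
  {XX XX' : ℝ → ℝ → EuclideanSpace ℝ (ι × ι)} {S S' : ℝ → ℝ → TSeries ι} {w : List ι} {s u t : ℝ}

theorem self_eq_zero (hS : IsLyonsExtension p T X XX S) (hs : 0 ≤ s) (hT : s ≤ T) (hw : w ≠ []) :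
    S s s w = 0 :=
  TSeries.eq_zero_of_tensor_self (hS.level_zero s s hs le_rfl hT)
    (hS.chen s s s hs le_rfl le_rfl hT) hw

theorem exists_control (hp : 0 < p) (hS : IsLyonsExtension p T X XX S) (hw : w ≠ []) :
    ∃ ω, IsControl T ω ∧ PowBound T ω (w.length / p) (fun s t => S s t w) := by
  have hlen : 0 < w.length := List.length_pos_iff.2 hw
  have hself : ∀ s, 0 ≤ s → s ≤ T → (S s s).level w.length = 0 := fun s hs hT => by
    ext v
    exact hS.self_eq_zero hs hT (List.ne_nil_of_length_pos (by rwa [List.length_ofFn]))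
  obtain ⟨ω, hω, hb⟩ := exists_control_of_variation_lt_top (by positivity)
    (hS.variation_lt_top _ hlen) hself
  rw [one_div_div] at hb
  refine ⟨ω, hω, (hb.apply w.get).congr fun s t _ _ _ => ?_⟩
  simp only [TSeries.level, List.ofFn_get]

theorem apply_eq_add_mid_add (hS : IsLyonsExtension p T X XX S) (hw : w ≠ []) (hs : 0 ≤ s)
    (hsu : s ≤ u) (hut : u ≤ t) (ht : t ≤ T) :
    S s t w = S u t w + (S s u).mid (S u t) w + S s u w := by
  rw [← hS.chen s u t hs hsu hut ht, TSeries.tensor_eq_mid _ _ hw,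
    hS.level_zero s u hs hsu (hut.trans ht), hS.level_zero u t (hs.trans hsu) hut ht, one_mul,
    mul_one]

theorem eq_of_forall_length_lt (hp : 0 < p) (hS : IsLyonsExtension p T X XX S)
    (hS' : IsLyonsExtension p T X XX' S') (hw : p < w.length)
    (hlt : ∀ v : List ι, v.length < w.length → ∀ s t, 0 ≤ s → s ≤ t → t ≤ T → S s t v = S' s t v)
    (hs : 0 ≤ s) (hst : s ≤ t) (ht : t ≤ T) : S s t w = S' s t w := by
  have hne : w ≠ [] := by rintro rfl; simp at hw; linarith
  obtain ⟨ω, hω, hb⟩ := hS.exists_control hp hne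
  obtain ⟨ω', hω', hb'⟩ := hS'.exists_control hp hne
  have hθ : 0 ≤ (w.length : ℝ) / p := by positivity
  have hbound : PowBound T (fun s t => ω s t + ω' s t) (w.length / p)
      (fun s t => S s t w - S' s t w) :=
    (hb.mono_control hω hθ fun s t hs hst ht =>
        le_add_of_nonneg_right (hω'.nonneg s t hs hst ht)).sub
      (hb'.mono_control hω' hθ fun s t hs hst ht =>
        le_add_of_nonneg_left (hω.nonneg s t hs hst ht))
  have hadd : ∀ s u t, 0 ≤ s → s ≤ u → u ≤ t → t ≤ T →
      S s t w - S' s t w = (S s u w - S' s u w) + (S u t w - S' u t w) := by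
    intro s u t hs hsu hut ht
    have hmid : (S s u).mid (S u t) w = (S' s u).mid (S' u t) w :=
      TSeries.mid_congr
        (fun k hk => hlt _ (by rw [List.length_take]; grind) s u hs hsu (hut.trans ht))
        (fun k hk => hlt _ (by rw [List.length_drop]; grind) u t (hs.trans hsu) hut ht)
    rw [hS.apply_eq_add_mid_add hne hs hsu hut ht, hS'.apply_eq_add_mid_add hne hs hsu hut ht, hmid]
    ring
  exact sub_eq_zero.1 (eq_zero_of_additive (hω.add hω') hadd
    ((hS.continuousOn w).sub (hS'.continuousOn w)) ((one_lt_div hp).2 hw) hbound hs hst ht)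

theorem unique (hp : 0 < p) (hp' : p < 3) (hS : IsLyonsExtension p T X XX S)
    (hS' : IsLyonsExtension p T X XX' S')
    (hXX : ∀ s t, 0 ≤ s → s ≤ t → t ≤ T → XX s t = XX' s t)
    (hs : 0 ≤ s) (hst : s ≤ t) (ht : t ≤ T) : S s t = S' s t := by
  funext w
  induction hlen : w.length using Nat.strong_induction_on generalizing w s t with
  | _ n ih =>
    match w with
    | [] => rw [hS.level_zero s t hs hst ht, hS'.level_zero s t hs hst ht]
    | [i] => rw [hS.level_one s t hs hst ht, hS'.level_one s t hs hst ht]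
    | [i, j] => rw [hS.level_two s t hs hst ht, hS'.level_two s t hs hst ht, hXX s t hs hst ht]
    | i :: j :: k :: v =>
      refine hS.eq_of_forall_length_lt hp hS' ?_
        (fun v hv s t hs hst ht => ih v.length (hlen ▸ hv) hs hst ht v rfl) hs hst ht
      simp only [List.length_cons, Nat.cast_add, Nat.cast_one]
      linarith [v.length.cast_nonneg (α := ℝ)]

end IsLyonsExtension

theorem HasYoungIntegral.unique {f g : ℝ → ℝ} {s t L L' : ℝ} (hst : s ≤ t)
    (h : HasYoungIntegral f g s t L) (h' : HasYoungIntegral f g s t L') : L = L' :=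
  have := meshZero_neBot hst
  tendsto_nhds_unique h h'

theorem IsExtLift.unique {d : ℕ} {T : ℝ} {X : ℝ → EuclideanSpace ℝ (Fin d)}
    {XX : ℝ → ℝ → EuclideanSpace ℝ (Fin d × Fin d)}
    {XXh XXh' : ℝ → ℝ → EuclideanSpace ℝ (ExtIndex d × ExtIndex d)}
    (h : IsExtLift T X XX XXh) (h' : IsExtLift T X XX XXh') {s t : ℝ} (hs : 0 ≤ s) (hst : s ≤ t)
    (ht : t ≤ T) : XXh s t = XXh' s t := by
  ext ⟨a, b⟩
  by_cases hab : (∃ i, a = .path i) ∧ ∃ j, b = .path j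
  · obtain ⟨⟨i, rfl⟩, j, rfl⟩ := hab
    rw [h.path_path s t hs hst ht, h'.path_path s t hs hst ht]
  · exact (h.young s t hs hst ht a b hab).unique hst (h'.young s t hs hst ht a b hab)

/-! ### The extended path -/

section RoughPath

variable {ι : Type*} [Fintype ι] {p T : ℝ} {X : ℝ → EuclideanSpace ℝ ι}
  {XX : ℝ → ℝ → EuclideanSpace ℝ (ι × ι)} {ω : ℝ → ℝ → ℝ}

/-- A control that dominates a rough path and time, with the exponents that make time and the
second level, hence also the bracket, of weight two. -/
structure IsRoughControl (p T : ℝ) (X : ℝ → EuclideanSpace ℝ ι)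
    (XX : ℝ → ℝ → EuclideanSpace ℝ (ι × ι)) (ω : ℝ → ℝ → ℝ) : Prop where
  isControl : IsControl T ω
  fst : ∀ i, PowBound T ω (1 / p) (fun s t => X t i - X s i)
  snd : ∀ i j, PowBound T ω (2 / p) (fun s t => XX s t (i, j))
  time : PowBound T ω (2 / p) (fun s t => t - s)

namespace IsRoughPath

theorem snd_self (hX : IsRoughPath p T X XX) {s : ℝ} (hs : 0 ≤ s) (hT : s ≤ T) : XX s s = 0 := by
  ext ⟨i, j⟩
  simpa using hX.chen s s s hs le_rfl le_rfl hT i j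

theorem exists_isRoughControl (hX : IsRoughPath p T X XX) (hp : 2 ≤ p) :
    ∃ ω, IsRoughControl p T X XX ω := by
  have hp0 : 0 < p := by linarith
  obtain ⟨ω₁, hω₁, hb₁⟩ := exists_control_of_variation_lt_top hp0 hX.variation_fst
    fun s _ _ => sub_self (X s)
  obtain ⟨ω₂, hω₂, hb₂⟩ := exists_control_of_variation_lt_top (half_pos hp0) hX.variation_snd
    fun s => hX.snd_self
  rw [one_div_div] at hb₂
  have htime : PowBound T (fun s t => t - s) (2 / p) (fun s t => t - s) := by
    refine .mono_exponent (.time T) (by positivity) ((div_le_one hp0).2 hp) ⟨1, zero_le_one, ?_⟩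
    intro s t _ hst _
    rw [Real.rpow_one, one_mul, Real.norm_of_nonneg (sub_nonneg.2 hst)]
  refine ⟨fun s t => ω₁ s t + ω₂ s t + (t - s), (hω₁.add hω₂).add (.time T),
    fun i => (hb₁.apply i).mono_control hω₁ (by positivity) ?_,
    fun i j => (hb₂.apply (i, j)).mono_control hω₂ (by positivity) ?_,
    htime.mono_control (.time T) (by positivity) ?_⟩
  all_goals
    intro s t hs hst ht
    linarith [hω₁.nonneg s t hs hst ht, hω₂.nonneg s t hs hst ht]

theorem bracket_sub (hX : IsRoughPath p T X XX) {s t : ℝ} (hs : 0 ≤ s) (hst : s ≤ t)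
    (ht : t ≤ T) (i j : ι) :
    bracket X XX t i j - bracket X XX s i j
      = (X t i - X s i) * (X t j - X s j) - (XX s t (i, j) + XX s t (j, i)) := by
  simp only [bracket, hX.chen 0 s t le_rfl hs hst ht]
  ring

theorem continuousOn_fst_apply (hX : IsRoughPath p T X XX) (i : ι) :
    ContinuousOn (fun t => X t i) (Set.Icc 0 T) :=
  (EuclideanSpace.proj (𝕜 := ℝ) i).continuous.comp_continuousOn hX.continuousOn_fst

theorem continuousOn_snd_apply (hX : IsRoughPath p T X XX) (i j : ι) :
    ContinuousOn (fun x : ℝ × ℝ => XX x.1 x.2 (i, j)) (simplex T) :=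
  (EuclideanSpace.proj (𝕜 := ℝ) (i, j)).continuous.comp_continuousOn hX.continuousOn_snd

theorem continuousOn_bracket (hX : IsRoughPath p T X XX) (i j : ι) :
    ContinuousOn (fun t => bracket X XX t i j) (Set.Icc 0 T) := by
  have hfst : ∀ i, ContinuousOn (fun t => X t i - X 0 i) (Set.Icc 0 T) := fun i =>
    (hX.continuousOn_fst_apply i).sub continuousOn_const
  have hsnd : ∀ i j, ContinuousOn (fun t => XX 0 t (i, j)) (Set.Icc 0 T) := fun i j =>
    (hX.continuousOn_snd_apply i j).comp (f := fun t : ℝ => ((0 : ℝ), t)) (by fun_prop)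
      fun t ht => ⟨le_rfl, ht⟩
  exact ((hfst i).mul (hfst j)).sub ((hsnd i j).add (hsnd j i))

end IsRoughPath

end RoughPath

section ExtendedPath

variable {d : ℕ}

/-- The weights of the letters of the extended path: in contrast to the paths of finite
`p`-variation `X`, time and the bracket have finite `p / 2`-variation. -/
def extWeight : ExtIndex d → ℕ
  | .path _ => 1
  | _ => 2

theorem one_le_extWeight (a : ExtIndex d) : 1 ≤ extWeight a := by
  cases a <;> simp [extWeight]

theorem cases_of_weight_le_two {w : List (ExtIndex d)} (hw : weight extWeight w ≤ 2) :
    w = [] ∨ (∃ a, w = [a]) ∨ ∃ i j, w = [.path i, .path j] := by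
  have hlen := length_le_weight one_le_extWeight w
  match w with
  | [] => exact Or.inl rfl
  | [a] => exact Or.inr (Or.inl ⟨a, rfl⟩)
  | [a, b] => cases a <;> cases b <;> simp_all [weight, extWeight]
  | a :: b :: c :: v => simp only [List.length_cons] at hlen; omega

theorem exists_path_path_of_weight_le_two {I J : List (ExtIndex d)} (hI : I ≠ []) (hJ : J ≠ [])
    (h : weight extWeight I + weight extWeight J ≤ 2) :
    ∃ i j, I = [.path i] ∧ J = [.path j] := by
  rw [← weight_append] at h
  rcases cases_of_weight_le_two h with hIJ | ⟨a, hIJ⟩ | ⟨i, j, hIJ⟩ <;>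
    rcases I with _ | ⟨b, _ | ⟨c, I⟩⟩ <;> simp_all

/-- The components of weight at most two of the signature of the extended path, the starting point
of its extension. On the heavier words, where it is `0`, it has no meaning. -/
def extBase (X : ℝ → EuclideanSpace ℝ (Fin d)) (XX : ℝ → ℝ → EuclideanSpace ℝ (Fin d × Fin d))
    (s t : ℝ) : TSeries (ExtIndex d)
  | [] => 1
  | [a] => extPath X XX t a - extPath X XX s a
  | [.path i, .path j] => XX s t (i, j)
  | _ => 0

variable {p T : ℝ} {X : ℝ → EuclideanSpace ℝ (Fin d)}
  {XX : ℝ → ℝ → EuclideanSpace ℝ (Fin d × Fin d)} {ω : ℝ → ℝ → ℝ}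

namespace IsRoughPath

theorem powBound_extPath (hX : IsRoughPath p T X XX) (hp : 0 < p)
    (hω : IsRoughControl p T X XX ω) (a : ExtIndex d) :
    PowBound T ω (extWeight a / p) (fun s t => extPath X XX t a - extPath X XX s a) := by
  cases a with
  | time => simpa [extWeight, extPath] using hω.time
  | path i => simpa [extWeight, extPath] using hω.fst i
  | brack ij =>
    have hfst : PowBound T ω (2 / p)
        (fun s t => (X t ij.1.1 - X s ij.1.1) * (X t ij.1.2 - X s ij.1.2)) := by
      rw [← one_add_one_eq_two, add_div]
      exact (hω.fst _).mul hω.isControl (by positivity) (by positivity) (hω.fst _)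
    simpa [extWeight, extPath] using
      (hfst.sub ((hω.snd ij.1.1 ij.1.2).add (hω.snd ij.1.2 ij.1.1))).congr
        fun s t hs hst ht => hX.bracket_sub hs hst ht _ _

theorem continuousOn_extPath (hX : IsRoughPath p T X XX) (a : ExtIndex d) :
    ContinuousOn (fun t => extPath X XX t a) (Set.Icc 0 T) := by
  cases a with
  | time => exact continuousOn_id
  | path i => exact hX.continuousOn_fst_apply i
  | brack ij => exact hX.continuousOn_bracket _ _

theorem isWeightedFunctional_extBase (hX : IsRoughPath p T X XX) (hp : 0 < p)
    (hω : IsRoughControl p T X XX ω) :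
    IsWeightedFunctional extWeight p T ω 2 (extBase X XX) where
  nil s t _ _ _ := rfl
  chen w hw s u t hs hsu hut ht := by
    rcases cases_of_weight_le_two hw with rfl | ⟨a, rfl⟩ | ⟨i, j, rfl⟩
    · simp [TSeries.tensor_nil, extBase]
    · simp [TSeries.tensor_eq_mid, TSeries.mid, extBase]
    · simp [TSeries.tensor_eq_mid, TSeries.mid, extBase, extPath, hX.chen s u t hs hsu hut ht i j]
      ring
  bound w hw := by
    rcases cases_of_weight_le_two hw with rfl | ⟨a, rfl⟩ | ⟨i, j, rfl⟩
    · exact ⟨1, zero_le_one, fun s t _ _ _ => by simp [extBase, weight_nil]⟩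
    · simpa [weight, extBase] using hX.powBound_extPath hp hω a
    · simpa [weight, extWeight, extBase, one_add_one_eq_two] using hω.snd i j
  continuousOn w hw := by
    rcases cases_of_weight_le_two hw with rfl | ⟨a, rfl⟩ | ⟨i, j, rfl⟩
    · exact continuousOn_const
    · refine ((hX.continuousOn_extPath a).comp _root_.continuousOn_snd ?_).sub
        ((hX.continuousOn_extPath a).comp _root_.continuousOn_fst ?_)
      · exact fun x hx => ⟨hx.1.trans hx.2.1, hx.2.2⟩
      · exact fun x hx => ⟨hx.1, hx.2.1.trans hx.2.2⟩
    · exact hX.continuousOn_snd_apply i j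

end IsRoughPath

/-- `S` is the signature of the extended path, with the homogeneity given by `extWeight`: a word
containing time or a bracket is smaller than a Lyons extension is required to be. -/
structure IsExtSignature (p T : ℝ) (X : ℝ → EuclideanSpace ℝ (Fin d))
    (XX : ℝ → ℝ → EuclideanSpace ℝ (Fin d × Fin d)) (ω : ℝ → ℝ → ℝ)
    (S : ℝ → ℝ → TSeries (ExtIndex d)) : Prop where
  isControl : IsControl T ω
  isWeightedFunctional : ∀ n, IsWeightedFunctional extWeight p T ω n S
  eq_extBase : ∀ s t w, weight extWeight w ≤ 2 → S s t w = extBase X XX s t w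

theorem IsRoughPath.exists_isExtSignature (hX : IsRoughPath p T X XX) (hp : 2 ≤ p) (hp' : p < 3) :
    ∃ ω S, IsExtSignature p T X XX ω S := by
  have hp0 : 0 < p := by linarith
  obtain ⟨ω, hω⟩ := hX.exists_isRoughControl hp
  obtain ⟨S, hS, hbase⟩ := (hX.isWeightedFunctional_extBase hp0 hω).exists_extension
    one_le_extWeight hp0 hω.isControl (by norm_num; linarith)
  exact ⟨ω, S, hω.isControl, hS, hbase⟩

/-- The second level of a family of tensor series, in the form in which a rough path stores it. -/
def secondLevel {ι : Type*} (S : ℝ → ℝ → TSeries ι) (s t : ℝ) : EuclideanSpace ℝ (ι × ι) :=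
  WithLp.toLp 2 fun ab => S s t [ab.1, ab.2]

namespace IsExtSignature

variable {S : ℝ → ℝ → TSeries (ExtIndex d)} {s u t : ℝ}

theorem nil (hS : IsExtSignature p T X XX ω S) (s t : ℝ) : S s t [] = 1 :=
  hS.eq_extBase s t [] (by simp [weight])

theorem singleton (hS : IsExtSignature p T X XX ω S) (s t : ℝ) (a : ExtIndex d) :
    S s t [a] = extPath X XX t a - extPath X XX s a :=
  hS.eq_extBase s t [a] (by cases a <;> simp [weight, extWeight])

theorem path_path (hS : IsExtSignature p T X XX ω S) (s t : ℝ) (i j : Fin d) :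
    S s t [.path i, .path j] = XX s t (i, j) :=
  hS.eq_extBase s t _ (by simp [weight, extWeight])

theorem chen (hS : IsExtSignature p T X XX ω S) (hs : 0 ≤ s) (hsu : s ≤ u) (hut : u ≤ t)
    (ht : t ≤ T) : (S s u).tensor (S u t) = S s t :=
  funext fun w => (hS.isWeightedFunctional _).chen w le_rfl s u t hs hsu hut ht

theorem chen_pair (hS : IsExtSignature p T X XX ω S) (hs : 0 ≤ s) (hsu : s ≤ u) (hut : u ≤ t)
    (ht : t ≤ T) (a b : ExtIndex d) :
    S s t [a, b] = S s u [a, b] + S u t [a, b]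
      + (extPath X XX u a - extPath X XX s a) * (extPath X XX t b - extPath X XX u b) := by
  rw [← hS.chen hs hsu hut ht, TSeries.tensor_eq_mid _ _ (List.cons_ne_nil a [b]), hS.nil, hS.nil]
  simp [TSeries.mid, hS.singleton]
  ring

theorem powBound (hS : IsExtSignature p T X XX ω S) (w : List (ExtIndex d)) :
    PowBound T ω (weight extWeight w / p) (fun s t => S s t w) :=
  (hS.isWeightedFunctional _).bound w le_rfl

theorem powBound_length (hS : IsExtSignature p T X XX ω S) (hp : 0 < p) (w : List (ExtIndex d)) :
    PowBound T ω (w.length / p) (fun s t => S s t w) :=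
  (hS.powBound w).mono_exponent hS.isControl (by positivity)
    (by gcongr; exact length_le_weight one_le_extWeight w)

theorem continuousOn (hS : IsExtSignature p T X XX ω S) (w : List (ExtIndex d)) :
    ContinuousOn (fun x : ℝ × ℝ => S x.1 x.2 w) (simplex T) :=
  (hS.isWeightedFunctional _).continuousOn w le_rfl

/-- By Chen's relation the Riemann sum differs from `S s t [a, b]` by the sum of `S u v [a, b]`
over the partition, and the weight `3 > p` of the word makes that sum negligible. -/
theorem hasYoungIntegral (hS : IsExtSignature p T X XX ω S) (hp : 0 < p) (hp' : p < 3)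
    (hs : 0 ≤ s) (hst : s ≤ t) (ht : t ≤ T) {a b : ExtIndex d}
    (hab : ¬ ((∃ i, a = .path i) ∧ ∃ j, b = .path j)) :
    HasYoungIntegral (fun r => extPath X XX r a - extPath X XX s a)
      (fun r => extPath X XX r b) s t (S s t [a, b]) := by
  have hweight : (3 : ℝ) ≤ weight extWeight [a, b] := by
    norm_cast
    cases a <;> cases b <;> simp_all [weight, extWeight]
  have hself : ∀ r, 0 ≤ r → r ≤ T → S r r [a, b] = 0 := fun r hr hT =>
    (hS.powBound [a, b]).self_eq_zero hS.isControl (by positivity) hr hT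
  have hlim := (SmallDiag.of_continuousOn (hS.continuousOn [a, b]) hself).tendsto_sum hS.isControl
    ((one_lt_div hp).2 (hp'.trans_le hweight)) (hS.powBound [a, b]) hs hst ht
  have hriemann : ∀ P : Partition s t,
      (P.sum fun u v => (extPath X XX u a - extPath X XX s a)
        * (extPath X XX v b - extPath X XX u b))
      = S s t [a, b] - P.sum fun u v => S u v [a, b] := fun P => by
    have htel := P.sum_sub fun r => S s r [a, b]
    rw [hself s hs (hst.trans ht), sub_zero] at htel
    rw [← htel, Partition.sum, Partition.sum, Partition.sum, ← Finset.sum_sub_distrib]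
    refine Finset.sum_congr rfl fun i _ => ?_
    rw [hS.chen_pair hs (P.mem_Icc i.castSucc).1 (P.pt_lt_pt_succ i).le
      ((P.mem_Icc i.succ).2.trans ht)]
    ring
  have hlim' := hlim.const_sub (S s t [a, b])
  rw [sub_zero] at hlim'
  exact hlim'.congr fun P => (hriemann P).symm

theorem isExtLift (hS : IsExtSignature p T X XX ω S) (hp : 0 < p) (hp' : p < 3) :
    IsExtLift T X XX (secondLevel S) where
  path_path s t _ _ _ i j := hS.path_path s t i j
  young _ _ hs hst ht _ _ hab := hS.hasYoungIntegral hp hp' hs hst ht hab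

theorem isRoughPath (hS : IsExtSignature p T X XX ω S) (hX : IsRoughPath p T X XX) (hp : 0 < p)
    (hT : 0 ≤ T) : IsRoughPath p T (extPath X XX) (secondLevel S) where
  continuousOn_fst := (PiLp.continuous_toLp 2 _).comp_continuousOn
    (continuousOn_pi.2 fun a => hX.continuousOn_extPath a)
  variation_fst := by
    refine PowBound.variation_lt_top hS.isControl hT hp (.of_apply fun a => ?_)
    simpa [hS.singleton] using hS.powBound_length hp [a]
  continuousOn_snd := (PiLp.continuous_toLp 2 _).comp_continuousOn
    (continuousOn_pi.2 fun ab => hS.continuousOn [ab.1, ab.2])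
  variation_snd := by
    refine PowBound.variation_lt_top hS.isControl hT (half_pos hp) (.of_apply fun ab => ?_)
    simpa [secondLevel, one_div_div] using hS.powBound_length hp [ab.1, ab.2]
  chen _ _ _ hs hsu hut ht a b := hS.chen_pair hs hsu hut ht a b

theorem isLyonsExtension (hS : IsExtSignature p T X XX ω S) (hp : 0 < p) (hT : 0 ≤ T) :
    IsLyonsExtension p T (extPath X XX) (secondLevel S) S where
  level_zero s t _ _ _ := hS.nil s t
  level_one s t _ _ _ a := hS.singleton s t a
  level_two _ _ _ _ _ _ _ := rfl
  chen _ _ _ hs hsu hut ht := hS.chen hs hsu hut ht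
  continuousOn w := hS.continuousOn w
  variation_lt_top m hm := by
    refine PowBound.variation_lt_top hS.isControl hT (by positivity) (.of_apply fun w => ?_)
    simpa [TSeries.level, one_div_div] using hS.powBound_length hp (List.ofFn w)

end IsExtSignature

end ExtendedPath

/-! ### Pairings with the tensor algebra -/

section Pairing

variable {ι : Type*}

theorem pairing_e (I : List ι) (a : TSeries ι) : pairing (e I) a = a I := by
  simp [pairing, e]

theorem pairing_zero (a : TSeries ι) : pairing 0 a = 0 := by
  simp [pairing]

theorem pairing_add (x y : TAlg ι) (a : TSeries ι) :
    pairing (x + y) a = pairing x a + pairing y a := by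
  simp only [pairing, MonoidAlgebra.coeff_add]
  exact Finsupp.sum_add_index' (by simp) (by intros; ring)

theorem pairing_smul (r : ℝ) (x : TAlg ι) (a : TSeries ι) :
    pairing (r • x) a = r * pairing x a := by
  simp only [pairing, MonoidAlgebra.coeff_smul]
  rw [Finsupp.sum_smul_index (by simp), Finsupp.mul_sum]
  simp only [mul_assoc]

theorem pairing_add_right (x : TAlg ι) (a b : TSeries ι) :
    pairing x (a + b) = pairing x a + pairing x b := by
  simp only [pairing, Pi.add_apply, mul_add, Finsupp.sum_add]

theorem pairing_smul_right (x : TAlg ι) (r : ℝ) (a : TSeries ι) :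
    pairing x (r • a) = r * pairing x a := by
  simp only [pairing, Pi.smul_apply, smul_eq_mul, Finsupp.mul_sum, mul_left_comm]

namespace TSeries

/-- The adjoint, with respect to `pairing`, of right multiplication by `x` in the tensor algebra. -/
def contract (a : TSeries ι) (x : TAlg ι) : TSeries ι := fun w => pairing (e w * x) a

theorem contract_zero (a : TSeries ι) : a.contract 0 = 0 := by
  funext w
  simp [contract, pairing_zero]

theorem contract_e (a : TSeries ι) (i : ι) (w : List ι) : a.contract (e [i]) w = a (w ++ [i]) := by
  rw [contract, e, e, MonoidAlgebra.single_mul_single]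
  simp [pairing]

theorem contract_e_tensor (a b : TSeries ι) (i : ι) :
    (a.tensor b).contract (e [i])
      = b [] • a.contract (e [i]) + a.tensor (b.contract (e [i])) := by
  funext w
  simp only [Pi.add_apply, Pi.smul_apply, smul_eq_mul, contract_e, tensor, List.length_append,
    List.length_singleton]
  rw [Finset.sum_range_succ, add_comm]
  congr 1
  · rw [List.take_of_length_le (by simp), List.drop_of_length_le (by simp), mul_comm]
  · refine Finset.sum_congr rfl fun k hk => ?_
    have hk' : k ≤ w.length := Nat.lt_succ_iff.1 (Finset.mem_range.1 hk)
    rw [List.take_append_of_le_length hk', List.drop_append_of_le_length hk']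

end TSeries

theorem pairing_mul (x y : TAlg ι) (a : TSeries ι) :
    pairing (x * y) a = pairing x (a.contract y) := by
  induction x using MonoidAlgebra.induction_linear with
  | zero => simp [pairing_zero]
  | add x x' hx hx' => rw [add_mul, pairing_add, pairing_add, hx, hx']
  | single w c =>
    have hsingle : (MonoidAlgebra.single w c : TAlg ι) = c • e (FreeMonoid.toList w) := by
      simp [e]
    rw [hsingle, smul_mul_assoc, pairing_smul, pairing_smul, pairing_e, TSeries.contract]

/-- The homogeneous elements of weight `n` of the tensor algebra. -/
def homogeneous (wt : ι → ℕ) (n : ℕ) : Submodule ℝ (TAlg ι) :=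
  Submodule.span ℝ (e '' {w | weight wt w = n})

theorem e_mem_homogeneous (wt : ι → ℕ) (w : List ι) : e w ∈ homogeneous wt (weight wt w) :=
  Submodule.subset_span ⟨w, rfl, rfl⟩

theorem mul_mem_homogeneous {wt : ι → ℕ} {m n : ℕ} {x y : TAlg ι} (hx : x ∈ homogeneous wt m)
    (hy : y ∈ homogeneous wt n) : x * y ∈ homogeneous wt (m + n) := by
  have hxy := Submodule.mul_mem_mul hx hy
  rw [homogeneous, homogeneous, Submodule.span_mul_span] at hxy
  refine Submodule.span_mono ?_ hxy
  rintro _ ⟨_, ⟨v, rfl, rfl⟩, _, ⟨w, rfl, rfl⟩, rfl⟩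
  exact ⟨v ++ w, weight_append wt v w, by simp [e, MonoidAlgebra.single_mul_single]⟩

theorem PowBound.pairing {wt : ι → ℕ} {p T : ℝ} {ω : ℝ → ℝ → ℝ} {S : ℝ → ℝ → TSeries ι}
    (hS : ∀ w, PowBound T ω (weight wt w / p) (fun s t => S s t w)) {n : ℕ} {x : TAlg ι}
    (hx : x ∈ homogeneous wt n) : PowBound T ω (n / p) (fun s t => pairing x (S s t)) := by
  induction hx using Submodule.span_induction with
  | mem _ hmem =>
    obtain ⟨w, rfl, rfl⟩ := hmem
    simpa only [pairing_e] using hS w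
  | zero => simpa only [pairing_zero] using PowBound.zero
  | add x y _ _ hx hy => simpa only [pairing_add] using hx.add hy
  | smul r x _ hx => simpa only [pairing_smul] using hx.const_mul r

theorem continuousOn_pairing {T : ℝ} {S : ℝ → ℝ → TSeries ι}
    (hS : ∀ w, ContinuousOn (fun x : ℝ × ℝ => S x.1 x.2 w) (simplex T)) (l : TAlg ι) :
    ContinuousOn (fun x : ℝ × ℝ => pairing l (S x.1 x.2)) (simplex T) :=
  continuousOn_finsetSum _ fun _ _ => continuousOn_const.mul (hS _)

end Pairing

/-! ### Deconcatenation of pairs of words -/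

section BiTensor

variable {ι : Type*}

/-- The product dual to deconcatenating the two words of a pair simultaneously. The words are
reversed, so that their last pieces form the first factor. -/
def biTensor (F G : List ι → List ι → ℝ) (I J : List ι) : ℝ :=
  ∑ k ∈ Finset.range (I.length + 1) ×ˢ Finset.range (J.length + 1),
    F (I.drop k.1) (J.drop k.2) * G (I.take k.1) (J.take k.2)

theorem biTensor_sub_biTensor {F F' G G' : List ι → List ι → ℝ} (hF : F [] [] = 1)
    (hF' : F' [] [] = 1) (hG : G [] [] = 1) (hG' : G' [] [] = 1) {I J : List ι} (hI : I ≠ [])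
    (hFF' : ∀ I' J' : List ι, I'.length + J'.length < I.length + J.length → F I' J' = F' I' J')
    (hGG' : ∀ I' J' : List ι, I'.length + J'.length < I.length + J.length → G I' J' = G' I' J') :
    biTensor F G I J - biTensor F' G' I J = (F I J - F' I J) + (G I J - G' I J) := by
  have hlen : 0 < I.length := List.length_pos_iff.2 hI
  rw [biTensor, biTensor, ← Finset.sum_sub_distrib,
    Finset.sum_eq_add_of_mem (0, 0) (I.length, J.length) (by simp) (by simp)
      (fun h => hlen.ne (congrArg Prod.fst h))]
  · simp [hF, hF', hG, hG']
  · rintro ⟨k, l⟩ hk ⟨hbot, htop⟩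
    simp only [Finset.mem_product, Finset.mem_range, ne_eq, Prod.mk.injEq] at hk hbot htop
    rw [hFF' _ _ (by simp only [List.length_drop]; omega),
      hGG' _ _ (by simp only [List.length_take]; omega), sub_self]

namespace TSeries

/-- The products of two coefficients of a tensor series, as a function of reversed words. -/
def coeffProd (a : TSeries ι) (I J : List ι) : ℝ := a I.reverse * a J.reverse

theorem tensor_reverse (a b : TSeries ι) (w : List ι) :
    a.tensor b w.reverse
      = ∑ k ∈ Finset.range (w.length + 1), a (w.drop k).reverse * b (w.take k).reverse := by
  rw [tensor, List.length_reverse, ← Finset.sum_range_reflect]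
  refine Finset.sum_congr rfl fun k hk => ?_
  have hk' : k ≤ w.length := Nat.lt_succ_iff.1 (Finset.mem_range.1 hk)
  rw [List.take_reverse, List.drop_reverse]
  congr 4 <;> omega

theorem coeffProd_tensor (a b : TSeries ι) :
    (a.tensor b).coeffProd = biTensor a.coeffProd b.coeffProd := by
  funext I J
  rw [coeffProd, tensor_reverse, tensor_reverse, Finset.sum_mul_sum, ← Finset.sum_product',
    biTensor]
  refine Finset.sum_congr rfl fun k _ => ?_
  simp only [coeffProd]
  ring

end TSeries

end BiTensor

/-! ### The quasi-shuffle product -/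

section QuasiShuffle

variable {d : ℕ}

theorem eps_eq_zero_or_eq_e (i j : ExtIndex d) :
    eps i j = 0 ∨ ∃ k, extWeight k = extWeight i + extWeight j ∧ eps i j = e [k] := by
  cases i with
  | path i =>
    cases j with
    | path j => exact Or.inr ⟨_, rfl, rfl⟩
    | _ => exact Or.inl rfl
  | _ => exact Or.inl rfl

theorem eps_mem_homogeneous (i j : ExtIndex d) :
    eps i j ∈ homogeneous extWeight (extWeight i + extWeight j) := by
  rcases eps_eq_zero_or_eq_e i j with h | ⟨k, hk, h⟩
  · exact h ▸ zero_mem _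
  · rw [h, ← hk]
    exact e_mem_homogeneous extWeight [k]

theorem quasiShuffleRev_nil_right (I : List (ExtIndex d)) : quasiShuffleRev I [] = e I.reverse := by
  cases I <;> rw [quasiShuffleRev]

theorem quasiShuffleRev_mem_homogeneous (I J : List (ExtIndex d)) :
    quasiShuffleRev I J ∈ homogeneous extWeight (weight extWeight I + weight extWeight J) := by
  induction I, J using quasiShuffleRev.induct with
  | case1 J =>
    rw [quasiShuffleRev, weight_nil, zero_add, ← weight_reverse]
    exact e_mem_homogeneous _ _
  | case2 i I =>
    rw [quasiShuffleRev, weight_nil, add_zero, ← weight_reverse]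
    exact e_mem_homogeneous _ _
  | case3 i I j J hI hJ hIJ =>
    have hi := mul_mem_homogeneous hI (e_mem_homogeneous extWeight [i])
    have hj := mul_mem_homogeneous hJ (e_mem_homogeneous extWeight [j])
    have hij := mul_mem_homogeneous hIJ (eps_mem_homogeneous i j)
    simp only [weight_cons, weight_nil, add_zero] at hi hj hij ⊢
    rw [quasiShuffleRev]
    refine add_mem (add_mem ?_ ?_) ?_
    · convert hi using 2; ring
    · convert hj using 2; ring
    · convert hij using 2; ring

namespace TSeries

variable (a b : TSeries (ExtIndex d))

theorem contract_eps_tensor (i j : ExtIndex d) :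
    (a.tensor b).contract (eps i j)
      = b [] • a.contract (eps i j) + a.tensor (b.contract (eps i j)) := by
  rcases eps_eq_zero_or_eq_e i j with h | ⟨k, -, h⟩ <;> rw [h]
  · funext w
    simp [contract_zero, tensor]
  · exact contract_e_tensor a b k

/-- The pairings of a tensor series with the quasi-shuffle products of reversed words. -/
def coQuasiShuffle (I J : List (ExtIndex d)) : ℝ := pairing (quasiShuffleRev I J) a

theorem coQuasiShuffle_nil_left (J : List (ExtIndex d)) : a.coQuasiShuffle [] J = a J.reverse := by
  rw [coQuasiShuffle, quasiShuffleRev, pairing_e]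

theorem coQuasiShuffle_nil_right (I : List (ExtIndex d)) :
    a.coQuasiShuffle I [] = a I.reverse := by
  rw [coQuasiShuffle, quasiShuffleRev_nil_right, pairing_e]

theorem coQuasiShuffle_cons_cons (i j : ExtIndex d) (I J : List (ExtIndex d)) :
    a.coQuasiShuffle (i :: I) (j :: J)
      = (a.contract (e [i])).coQuasiShuffle I (j :: J)
        + (a.contract (e [j])).coQuasiShuffle (i :: I) J
        + (a.contract (eps i j)).coQuasiShuffle I J := by
  rw [coQuasiShuffle, quasiShuffleRev, pairing_add, pairing_add, pairing_mul, pairing_mul,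
    pairing_mul]
  rfl

theorem coQuasiShuffle_add_smul (r : ℝ) (I J : List (ExtIndex d)) :
    (r • a + b).coQuasiShuffle I J = r * a.coQuasiShuffle I J + b.coQuasiShuffle I J := by
  rw [coQuasiShuffle, pairing_add_right, pairing_smul_right]
  rfl

theorem biTensor_coQuasiShuffle_cons_cons (i j : ExtIndex d) (I J : List (ExtIndex d)) :
    biTensor a.coQuasiShuffle b.coQuasiShuffle (i :: I) (j :: J)
      = b [] * a.coQuasiShuffle (i :: I) (j :: J)
        + biTensor a.coQuasiShuffle (b.contract (e [i])).coQuasiShuffle I (j :: J)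
        + biTensor a.coQuasiShuffle (b.contract (e [j])).coQuasiShuffle (i :: I) J
        + biTensor a.coQuasiShuffle (b.contract (eps i j)).coQuasiShuffle I J := by
  simp only [biTensor, Finset.sum_product, List.length_cons]
  simp only [Finset.sum_range_succ' _ (I.length + 1), Finset.sum_range_succ' _ (J.length + 1),
    List.drop_succ_cons, List.take_succ_cons, List.drop_zero, List.take_zero,
    coQuasiShuffle_cons_cons b, coQuasiShuffle_nil_left, coQuasiShuffle_nil_right, contract_e,
    mul_add, Finset.sum_add_distrib, List.reverse_cons, List.reverse_nil]
  ring

theorem coQuasiShuffle_tensor (I J : List (ExtIndex d)) :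
    (a.tensor b).coQuasiShuffle I J = biTensor a.coQuasiShuffle b.coQuasiShuffle I J := by
  induction I, J using quasiShuffleRev.induct generalizing b with
  | case1 J =>
    rw [coQuasiShuffle_nil_left, tensor_reverse]
    simp [biTensor, coQuasiShuffle_nil_left]
  | case2 i I =>
    rw [coQuasiShuffle_nil_right, tensor_reverse]
    simp [biTensor, coQuasiShuffle_nil_right]
  | case3 i I j J hI hJ hIJ =>
    rw [coQuasiShuffle_cons_cons, contract_e_tensor, contract_e_tensor, contract_eps_tensor,
      coQuasiShuffle_add_smul, coQuasiShuffle_add_smul, coQuasiShuffle_add_smul, hI, hJ, hIJ,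
      biTensor_coQuasiShuffle_cons_cons, coQuasiShuffle_cons_cons a]
    ring

end TSeries

end QuasiShuffle

/-! ### The quasi-shuffle identity -/

namespace IsExtSignature

variable {d : ℕ} {p T : ℝ} {X : ℝ → EuclideanSpace ℝ (Fin d)}
  {XX : ℝ → ℝ → EuclideanSpace ℝ (Fin d × Fin d)} {ω : ℝ → ℝ → ℝ}
  {S : ℝ → ℝ → TSeries (ExtIndex d)} {s u t : ℝ}

theorem coeffProd_path_path (hS : IsExtSignature p T X XX ω S) (hX : IsRoughPath p T X XX)
    (hs : 0 ≤ s) (hst : s ≤ t) (ht : t ≤ T) (i j : Fin d) :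
    (S s t).coeffProd [.path i] [.path j] = (S s t).coQuasiShuffle [.path i] [.path j] := by
  have hbracket := hX.bracket_sub hs hst ht (min i j) (max i j)
  rw [TSeries.coQuasiShuffle_cons_cons, TSeries.coQuasiShuffle_nil_left,
    TSeries.coQuasiShuffle_nil_right, TSeries.coQuasiShuffle_nil_left]
  simp only [eps, TSeries.coeffProd, TSeries.contract_e, List.reverse_singleton, List.reverse_nil,
    List.nil_append, List.cons_append, hS.path_path, hS.singleton, extPath]
  rw [hbracket]
  rcases le_total i j with h | h
  · rw [min_eq_left h, max_eq_right h]; ring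
  · rw [min_eq_right h, max_eq_left h]; ring

theorem powBound_coeffProd_sub (hS : IsExtSignature p T X XX ω S) (hp : 0 < p)
    (I J : List (ExtIndex d)) :
    PowBound T ω (((weight extWeight I + weight extWeight J : ℕ) : ℝ) / p)
      (fun s t => (S s t).coeffProd I J - (S s t).coQuasiShuffle I J) := by
  refine .sub ?_ (.pairing hS.powBound (quasiShuffleRev_mem_homogeneous I J))
  have hprod := (hS.powBound I.reverse).mul hS.isControl (by positivity) (by positivity)
    (hS.powBound J.reverse)
  rwa [weight_reverse, weight_reverse, ← add_div, ← Nat.cast_add] at hprod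

theorem continuousOn_coeffProd_sub (hS : IsExtSignature p T X XX ω S) (I J : List (ExtIndex d)) :
    ContinuousOn (fun x : ℝ × ℝ => (S x.1 x.2).coeffProd I J - (S x.1 x.2).coQuasiShuffle I J)
      (simplex T) :=
  ((hS.continuousOn I.reverse).mul (hS.continuousOn J.reverse)).sub
    (continuousOn_pairing hS.continuousOn (quasiShuffleRev I J))

theorem coeffProd_sub_coQuasiShuffle {I J : List (ExtIndex d)}
    (hS : IsExtSignature p T X XX ω S) (hI : I ≠ [])
    (hlt : ∀ I' J' : List (ExtIndex d), I'.length + J'.length < I.length + J.length →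
      ∀ s t, 0 ≤ s → s ≤ t → t ≤ T → (S s t).coeffProd I' J' = (S s t).coQuasiShuffle I' J')
    (hs : 0 ≤ s) (hsu : s ≤ u) (hut : u ≤ t) (ht : t ≤ T) :
    (S s t).coeffProd I J - (S s t).coQuasiShuffle I J
      = ((S s u).coeffProd I J - (S s u).coQuasiShuffle I J)
        + ((S u t).coeffProd I J - (S u t).coQuasiShuffle I J) := by
  rw [← hS.chen hs hsu hut ht, TSeries.coeffProd_tensor, TSeries.coQuasiShuffle_tensor]
  exact biTensor_sub_biTensor (by simp [TSeries.coeffProd, hS.nil])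
    (by simp [TSeries.coQuasiShuffle_nil_left, hS.nil]) (by simp [TSeries.coeffProd, hS.nil])
    (by simp [TSeries.coQuasiShuffle_nil_left, hS.nil]) hI
    (fun I' J' h => hlt I' J' h s u hs hsu (hut.trans ht))
    (fun I' J' h => hlt I' J' h u t (hs.trans hsu) hut ht)

theorem coeffProd_eq_coQuasiShuffle (hS : IsExtSignature p T X XX ω S)
    (hX : IsRoughPath p T X XX) (hp : 0 < p) (hp' : p < 3) (I J : List (ExtIndex d)) (hs : 0 ≤ s)
    (hst : s ≤ t) (ht : t ≤ T) : (S s t).coeffProd I J = (S s t).coQuasiShuffle I J := by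
  induction hn : I.length + J.length using Nat.strong_induction_on generalizing I J s t with
  | _ n ih =>
    rcases eq_or_ne I [] with rfl | hI
    · rw [TSeries.coQuasiShuffle_nil_left, TSeries.coeffProd, List.reverse_nil, hS.nil, one_mul]
    rcases eq_or_ne J [] with rfl | hJ
    · rw [TSeries.coQuasiShuffle_nil_right, TSeries.coeffProd, List.reverse_nil, hS.nil, mul_one]
    rcases le_or_gt (weight extWeight I + weight extWeight J) 2 with hw | hw
    · obtain ⟨i, j, rfl, rfl⟩ := exists_path_path_of_weight_le_two hI hJ hw
      exact hS.coeffProd_path_path hX hs hst ht i j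
    have hθ : 1 < ((weight extWeight I + weight extWeight J : ℕ) : ℝ) / p :=
      (one_lt_div hp).2 (hp'.trans_le (by exact_mod_cast hw))
    refine sub_eq_zero.1 (eq_zero_of_additive (D := fun s t => (S s t).coeffProd I J
      - (S s t).coQuasiShuffle I J) hS.isControl (fun s u t => ?_)
      (hS.continuousOn_coeffProd_sub I J) hθ (hS.powBound_coeffProd_sub hp I J) hs hst ht)
    exact hS.coeffProd_sub_coQuasiShuffle hI fun I' J' h s t hs hst ht =>
      ih _ (hn ▸ h) I' J' hs hst ht rfl

theorem mul_eq_pairing_quasiShuffle (hS : IsExtSignature p T X XX ω S)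
    (hX : IsRoughPath p T X XX) (hp : 0 < p) (hp' : p < 3) (I J : List (ExtIndex d)) (hs : 0 ≤ s)
    (hst : s ≤ t) (ht : t ≤ T) : S s t I * S s t J = pairing (quasiShuffle I J) (S s t) := by
  simpa [TSeries.coeffProd, TSeries.coQuasiShuffle, quasiShuffle] using
    hS.coeffProd_eq_coQuasiShuffle hX hp hp' I.reverse J.reverse hs hst ht

end IsExtSignature

end RoughSig

end

open RoughSig in
theorem mainTheorem2 (d : ℕ) (p T : ℝ) (hp : 2 < p) (hp' : p < 3) (hT : 0 < T)
    (X : ℝ → EuclideanSpace ℝ (Fin d)) (XX : ℝ → ℝ → EuclideanSpace ℝ (Fin d × Fin d))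
    (hX : IsRoughPath p T X XX) :
    (∃ XXh S, IsExtLift T X XX XXh ∧ IsRoughPath p T (extPath X XX) XXh ∧
      IsLyonsExtension p T (extPath X XX) XXh S) ∧
    ∀ XXh S, IsExtLift T X XX XXh → IsLyonsExtension p T (extPath X XX) XXh S →
      ∀ I J : List (ExtIndex d), ∀ t ∈ Set.Icc 0 T,
        pairing (e I) (S 0 t) * pairing (e J) (S 0 t) =
          pairing (quasiShuffle I J) (S 0 t) := by
  have hp0 : 0 < p := by linarith
  obtain ⟨ω, R, hR⟩ := hX.exists_isExtSignature hp.le hp'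
  have hlift := hR.isExtLift hp0 hp'
  have hlyons := hR.isLyonsExtension hp0 hT.le
  refine ⟨⟨_, R, hlift, hR.isRoughPath hX hp0 hT.le, hlyons⟩, fun XXh S hXXh hS I J t ht => ?_⟩
  have hSR : S 0 t = R 0 t := hS.unique hp0 hp' hlyons
    (fun s t hs hst ht => hXXh.unique hlift hs hst ht) le_rfl ht.1 ht.2
  rw [hSR, pairing_e, pairing_e]
  exact hR.mul_eq_pairing_quasiShuffle hX hp0 hp' I J le_rfl ht.1 ht.2
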